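/- Let $\mathbb F_{p^m}$ be a finite field, let $R=\mathbb F_{p^m}+u\mathbb F_{p^m}$ with $u^2=0$, let $\Theta$ be a ring automorphism of $R$, let $n\ge 1$ be a multiple of the order of $\Theta$, and let $\lambda\in\{1,-1\}$. Let $R[x;\Theta]$ be the skew polynomial ring with $xa=\Theta(a)x$, and let $\mathbb F_{p^m}[x;\theta]\subset R[x;\Theta]$ be the subring of skew polynomials with all coefficients in $\mathbb F_{p^m}$ (the automorphism $\Theta$ maps $\mathbb F_{p^m}$ onto itself; $\theta$ is its restriction). Then $x^n-\lambda$ is central. If $g$ is a monic right divisor of $x^n-\lambda$, let $\frac{x^n-\lambda}{g}$ denote the unique $q$ with $x^n-\lambda=qg$. Let $R[x,x^{-1};\Theta]$ be the localization of $R[x;\Theta]$ at the powers of $x$, and let $\varphi:R[x;\Theta]\to R[x,x^{-1};\Theta]$ be the map $\varphi(\sum_i a_ix^i)=\sum_i x^{-i}a_i$. For $f\in\mathbb F_{p^m}[x;\theta]$ let $\overleftarrow{f}^{\,u}$ be the unique element of $\mathbb F_{p^m}[x;\theta]$ with $fu=u\,\overleftarrow{f}^{\,u}$. Left ideals $C$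 of $R[x;\Theta]/\langle x^n-\lambda\rangle$ are identified with the codes $\{(c_0,\dots,c_{n-1})\in R^n : c_0+c_1x+\dots+c_{n-1}x^{n-1}\in C\}$, and the skew polynomials in $C$ are the representatives of degree less than $n$ of its elements. The Euclidean dual is $C^\perp=\{v\in R^n:\sum_i v_ic_i=0\text{ for all }c\in C\}$, and $\langle\cdots\rangle$ denotes the left ideal of the quotient ring generated by the elements listed. Let $A$ be the set of non-zero skew polynomials of minimal degree in $C$. Below, $g_0,g_1,f_0,f_1$ always lie in $\mathbb F_{p^m}[x;\theta]$, and the zero polynomial has degree $-\infty$ in comparisons of degrees. We say that * $C$ has type LI-1 with generator $g_0+ug_1$ if either $C=0$ and $g_0+ug_1=x^n-\lambda$, or $g_0+ug_1$ is a monic element of $A$; * $C$ has type LI-2 with generator $ug_1$ if $C$ contains no monic skew polynomial, $g_1$ is monic and $ug_1\in A$; * $C$ has type LI-3 with generators $ug_1$, $f_0+uf_1$ if $A$ contains no monic skew polynomial, $g_1$ is monic, $ug_1\in A$, $f_0+uf_1$ is a monic skew polynomial of minimal degree among the monic skew polynomials in $C$, and $\deg f_1<\deg g_1$. **Theorem.**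 For every left ideal $C$ of $R[x;\Theta]/\langle x^n-\lambda\rangle$ the Euclidean dual $C^\perp$ is again a left ideal of $R[x;\Theta]/\langle x^n-\lambda\rangle$. Every $C$ has one of the three types, for suitable generators, and $C^\perp$ is determined as follows. 1. If $C$ has type LI-1 with generator $g_0+ug_1$, then $C=\langle g_0+ug_1\rangle$, the skew polynomial $g_0+ug_1$ is a right divisor of $x^n-\lambda$, and $$C^\perp=\Big\langle x^{n-\deg g_0}\,\varphi\Big(\frac{x^n-\lambda}{g_0+ug_1}\Big)\Big\rangle .$$ 2. If $C$ has type LI-2 with generator $ug_1$, then $C=\langle ug_1\rangle$, the skew polynomial $g_1$ is a right divisor of $x^n-\lambda$, and $$C^\perp=\Big\langle u,\ x^{n-\deg g_1}\,\varphi\Big(\frac{x^n-\lambda}{g_1}\Big)\Big\rangle .$$ 3. If $C$ has type LI-3 with generators $ug_1$, $f_0+uf_1$, then $C=\langle ug_1,f_0+uf_1\rangle$, the skew polynomials $g_1$ and $f_0$ are right divisors of $x^n-\lambda$, and there exists $m\in\mathbb F_{p^m}[x;\theta]$ such that $$m\,g_1=\overleftarrow{\Big(\frac{x^n-\lambda}{f_0}\Big)}^{\,u}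 f_1$$ and $$C^\perp=\Big\langle x^{n-\deg f_0}\,\varphi\Big(\frac{x^n-\lambda}{f_0}\,u\Big),\ x^{n-\deg g_1}\,\varphi\Big(\frac{x^n-\lambda}{g_1}-u\,m\Big)\Big\rangle .$$ In each case the displayed generators of $C^\perp$, formed in $R[x,x^{-1};\Theta]$, lie in $R[x;\Theta]$. -/

import Mathlib

noncomputable section

namespace SkewCode

/-! ### Skew polynomials and skew Laurent polynomials -/

/-- The ring `R`, regarded as the coefficient ring of the skew polynomial ring `R[x; Θ]`.
The type remembers `Θ`, so that the action of the powers of `Θ` can be an instance. -/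
def Coeff {R : Type*} [CommRing R] (_Θ : RingAut R) : Type _ := R

section General

variable {R : Type*} [CommRing R] (Θ : RingAut R)

instance : CommRing (Coeff Θ) := inferInstanceAs (CommRing R)

/-- The identity map from `R` to the coefficient ring of `R[x; Θ]`. -/
def toCoeff : R ≃+* Coeff Θ := RingEquiv.refl R

/-- The exponent `k : ℕ` acts on coefficients by `Θ ^ k`. -/
instance : MulSemiringAction (Multiplicative ℕ) (Coeff Θ) where
  smul k a := toCoeff Θ ((Θ ^ k.toAdd) ((toCoeff Θ).symm a))
  one_smul a := by
    change toCoeff Θ ((Θ ^ (0 : ℕ)) _) = a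
    simp
  mul_smul k l a := by
    change toCoeff Θ ((Θ ^ (k.toAdd + l.toAdd)) _) = toCoeff Θ ((Θ ^ _) ((Θ ^ _) _))
    rw [pow_add]
    rfl
  smul_zero k := by
    change toCoeff Θ ((Θ ^ _) _) = 0
    simp
  smul_add k a b := by
    change toCoeff Θ ((Θ ^ _) _) = toCoeff Θ ((Θ ^ _) _) + toCoeff Θ ((Θ ^ _) _)
    simp
  smul_one k := by
    change toCoeff Θ ((Θ ^ _) _) = 1
    simp
  smul_mul k a b := by
    change toCoeff Θ ((Θ ^ _) _) = toCoeff Θ ((Θ ^ _) _) * toCoeff Θ ((Θ ^ _) _)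
    simp

/-- The exponent `k : ℤ` acts on coefficients by `Θ ^ k`. -/
instance : MulSemiringAction (Multiplicative ℤ) (Coeff Θ) where
  smul k a := toCoeff Θ ((Θ ^ k.toAdd) ((toCoeff Θ).symm a))
  one_smul a := by
    change toCoeff Θ ((Θ ^ (0 : ℤ)) _) = a
    simp
  mul_smul k l a := by
    change toCoeff Θ ((Θ ^ (k.toAdd + l.toAdd)) _) = toCoeff Θ ((Θ ^ _) ((Θ ^ _) _))
    rw [zpow_add]
    rfl
  smul_zero k := by
    change toCoeff Θ ((Θ ^ _) _) = 0
    simp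
  smul_add k a b := by
    change toCoeff Θ ((Θ ^ _) _) = toCoeff Θ ((Θ ^ _) _) + toCoeff Θ ((Θ ^ _) _)
    simp
  smul_one k := by
    change toCoeff Θ ((Θ ^ _) _) = 1
    simp
  smul_mul k a b := by
    change toCoeff Θ ((Θ ^ _) _) = toCoeff Θ ((Θ ^ _) _) * toCoeff Θ ((Θ ^ _) _)
    simp

/-- The skew polynomial ring `R[x; Θ]`, with `x a = Θ(a) x`. -/
abbrev SkewPoly : Type _ := SkewPolynomial (Coeff Θ)

/-- The skew Laurent polynomial ring `R[x, x⁻¹; Θ]`, with `x ^ k a = Θ ^ k (a) x ^ k` for `k : ℤ`.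
As `Θ` is bijective, this is the localization of `R[x; Θ]` at the powers of `x`. -/
abbrev SkewLaurent : Type _ := SkewMonoidAlgebra (Coeff Θ) (Multiplicative ℤ)

variable {Θ}

/-- The degree of a skew polynomial, `⊥` for the zero polynomial. -/
def degree (f : SkewPoly Θ) : WithBot ℕ := f.support.max

/-- The degree of a skew polynomial as a natural number (`0` for the zero polynomial). -/
def natDegree (f : SkewPoly Θ) : ℕ := f.support.sup id

/-- The leading coefficient is `1`. -/
def Monic (f : SkewPoly Θ) : Prop := f.coeff (natDegree f) = 1

/-- `g` is a right divisor of `f`. -/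
def IsRightDivisor (g f : SkewPoly Θ) : Prop := ∃ q : SkewPoly Θ, f = q * g

open Classical in
/-- The right quotient `f / g`, i.e. the skew polynomial `q` with `f = q * g`, when `g` is a right
divisor of `f` (for monic `g` it is unique); otherwise `0`. -/
def rightQuot (f g : SkewPoly Θ) : SkewPoly Θ :=
  if h : ∃ q : SkewPoly Θ, f = q * g then h.choose else 0

theorem rightQuot_mul {f g : SkewPoly Θ} (h : IsRightDivisor g f) : f = rightQuot f g * g := by
  unfold rightQuot
  rw [dif_pos (show ∃ q : SkewPoly Θ, f = q * g from h)]
  exact (show ∃ q : SkewPoly Θ, f = q * g from h).choose_spec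

variable (Θ) in
/-- The power `x ^ k` of the variable in the skew Laurent polynomial ring, `k : ℤ`. -/
def xPow (k : ℤ) : SkewLaurent Θ := SkewMonoidAlgebra.single (Multiplicative.ofAdd k) 1

/-- A constant, as a skew Laurent polynomial. -/
def constL (a : Coeff Θ) : SkewLaurent Θ := SkewMonoidAlgebra.single 1 a

/-- The inclusion of `R[x; Θ]` into `R[x, x⁻¹; Θ]`, `∑ aᵢ xⁱ ↦ ∑ aᵢ xⁱ`. -/
def toLaurent (f : SkewPoly Θ) : SkewLaurent Θ :=
  f.sum fun i a => constL a * xPow Θ i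

/-- The map `φ : R[x; Θ] → R[x, x⁻¹; Θ]`, `φ(∑ aᵢ xⁱ) = ∑ x⁻ⁱ aᵢ`. -/
def antiMap (f : SkewPoly Θ) : SkewLaurent Θ :=
  f.sum fun i a => xPow Θ (-(i : ℤ)) * constL a

variable (Θ) in
/-- The skew polynomial `xⁿ - lam`. -/
def modulus (n : ℕ) (lam : R) : SkewPoly Θ :=
  SkewPolynomial.X ^ n - SkewPolynomial.C (toCoeff Θ lam)

/-! ### The quotient ring, codes, and Euclidean duals -/

variable (Θ) in
/-- The quotient ring `R[x; Θ] / ⟨xⁿ - lam⟩`. Its left ideals are the terms of type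
`Ideal (SkewQuot Θ n lam)`. -/
abbrev SkewQuot (n : ℕ) (lam : R) : Type _ :=
  (TwoSidedIdeal.span {modulus Θ n lam}).ringCon.Quotient

variable (Θ) in
/-- The residue class map `R[x; Θ] → R[x; Θ] / ⟨xⁿ - lam⟩`. -/
def mk (n : ℕ) (lam : R) : SkewPoly Θ →+* SkewQuot Θ n lam :=
  (TwoSidedIdeal.span {modulus Θ n lam}).ringCon.mk'

variable (Θ) in
/-- The skew polynomial `c₀ + c₁ x + ⋯ + cₙ₋₁ xⁿ⁻¹` of a word `c` of length `n`. -/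
def wordPoly {n : ℕ} (c : Fin n → R) : SkewPoly Θ :=
  ∑ i : Fin n, SkewPolynomial.monomial (i : ℕ) (toCoeff Θ (c i))

/-- The code of length `n` given by a left ideal of `R[x; Θ] / ⟨xⁿ - lam⟩`: all words whose skew
polynomial lies in the ideal. -/
def code {n : ℕ} {lam : R} (I : Ideal (SkewQuot Θ n lam)) : Set (Fin n → R) :=
  {c | mk Θ n lam (wordPoly Θ c) ∈ I}

/-- The Euclidean dual of a code. -/
def euclideanDual {n : ℕ} (S : Set (Fin n → R)) : Set (Fin n → R) :=
  {v | ∀ c ∈ S, ∑ i, v i * c i = 0}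

/-- The skew polynomials in a left ideal of `R[x; Θ] / ⟨xⁿ - lam⟩`: the representatives of degree
less than `n` of its elements. -/
def polys {n : ℕ} {lam : R} (I : Ideal (SkewQuot Θ n lam)) : Set (SkewPoly Θ) :=
  {f | degree f < n ∧ mk Θ n lam f ∈ I}

/-- The non-zero skew polynomials of minimal degree in a left ideal. -/
def minPolys {n : ℕ} {lam : R} (I : Ideal (SkewQuot Θ n lam)) : Set (SkewPoly Θ) :=
  {f | f ∈ polys I ∧ f ≠ 0 ∧ ∀ h ∈ polys I, h ≠ 0 → degree f ≤ degree h}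

end General

/-! ### The ring `F + uF` and the three types of left ideals -/

section DualNumbers

variable {F : Type*} [Field F] {Θ : RingAut (DualNumber F)}

/-- All coefficients of `f` lie in the subfield `F` of `F + uF`, i.e. `f` lies in `F[x; θ]`. -/
def OverField (f : SkewPoly Θ) : Prop :=
  ∀ i, TrivSqZeroExt.snd ((toCoeff Θ).symm (f.coeff i)) = 0

variable (Θ) in
/-- The constant skew polynomial `u`. -/
def uPoly : SkewPoly Θ := SkewPolynomial.C (toCoeff Θ DualNumber.eps)

/-- For `f` in `F[x; θ]`, the skew polynomial `w` in `F[x; θ]` with `f u = u w`; its `i`-th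
coefficient is the `u`-part of the `i`-th coefficient of `f u`. -/
def leftShift (f : SkewPoly Θ) : SkewPoly Θ :=
  (f * uPoly Θ).sum fun i a => SkewPolynomial.monomial i
    (toCoeff Θ (TrivSqZeroExt.inl (TrivSqZeroExt.snd ((toCoeff Θ).symm a))))

variable {n : ℕ} {lam : DualNumber F}

/-- `I` has type LI-1 with generator `g₀ + u g₁`: either `I = 0` and `g₀ + u g₁ = xⁿ - lam`, or
`g₀ + u g₁` is a monic skew polynomial of minimal degree in `I`. -/
structure IsLI1 (I : Ideal (SkewQuot Θ n lam)) (g₀ g₁ : SkewPoly Θ) : Prop where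
  over₀ : OverField g₀
  over₁ : OverField g₁
  gen : (I = ⊥ ∧ g₀ + uPoly Θ * g₁ = modulus Θ n lam) ∨
    (Monic (g₀ + uPoly Θ * g₁) ∧ g₀ + uPoly Θ * g₁ ∈ minPolys I)

/-- `I` has type LI-2 with generator `u g₁`: there are no monic skew polynomials in `I`, and
`u g₁` is a skew polynomial with leading coefficient `u` of minimal degree in `I`. -/
structure IsLI2 (I : Ideal (SkewQuot Θ n lam)) (g₁ : SkewPoly Θ) : Prop where
  no_monic : ∀ h ∈ polys I, ¬ Monic h
  over₁ : OverField g₁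
  monic₁ : Monic g₁
  gen : uPoly Θ * g₁ ∈ minPolys I

/-- `I` has type LI-3 with generators `u g₁`, `f₀ + u f₁`: no skew polynomial of minimal degree in
`I` is monic, `u g₁` is one with leading coefficient `u`, and `f₀ + u f₁` has minimal degree among
the monic skew polynomials in `I` and satisfies `deg f₁ < deg g₁`. -/
structure IsLI3 (I : Ideal (SkewQuot Θ n lam)) (g₁ f₀ f₁ : SkewPoly Θ) : Prop where
  no_monic : ∀ h ∈ minPolys I, ¬ Monic h
  over_g₁ : OverField g₁
  monic_g₁ : Monic g₁
  gen₁ : uPoly Θ * g₁ ∈ minPolys I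
  over_f₀ : OverField f₀
  over_f₁ : OverField f₁
  monic_f : Monic (f₀ + uPoly Θ * f₁)
  gen₂ : f₀ + uPoly Θ * f₁ ∈ polys I
  min_f : ∀ h ∈ polys I, Monic h → degree (f₀ + uPoly Θ * f₁) ≤ degree h
  deg_lt : degree f₁ < degree g₁

end DualNumbers

end SkewCode

end

noncomputable section

namespace SkewCode

open SkewPolynomial

/-! ### Arithmetic of skew polynomials: coefficients, degrees, monic elements, division -/

section General

variable {R : Type*} [CommRing R] {Θ : RingAut R}

/-! Write M for xⁿ - λ. It is central, because Θⁿ = 1 and Θ fixes λ, and x is a unit modulo M. Since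
x⁻ⁿ = λ⁻¹ = λ, the map φ descends to an involutive anti-automorphism `anti` of the quotient. The
constant term of v · anti(c) is ∑ vᵢcᵢ (`constTerm_mul_anti`). A left ideal I is stable under
multiplication by x, so orthogonality to I amounts to v · anti(t) = 0 for all t in I: the Euclidean
dual is the image under `anti` of the right annihilator of I. It therefore suffices to find right
ideal generators of that annihilator (`euclideanDual_code_span_pair`); a power of x is a unit and
only serves to make their images polynomial.

The annihilators come from factorisations M = hg with g monic, for which also M = gh. If g generates
I, then gw = 0 in the quotient means gw = gh·b as polynomials, so w = hb. If I is generated by u g₁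
with M = g₁h, only w modulo u matters, and the annihilator is generated by u and h.

For type LI-3 put M = k g₁ = l f₀. The element l(f₀ + u f₁) - M of I is a multiple of u, which gives
m with u m g₁ = l u f₁. Both l u and k - u m annihilate I. Conversely, if w annihilates u g₁, its
part modulo u is k b, so w = (k - u m)b + u v; annihilating f₀ + u f₁ as well then forces u v into l
u R[x; Θ].

The structure of I itself rests on division with remainder in F[x; θ] and on
`exists_monicAt_of_fstPart_ne_zero`: an element of I that is nonzero modulo u can be replaced by a
monic one whose degree is that of its part modulo u. -/

theorem coeff_monomial_mul (k : ℕ) (a : Coeff Θ) (f : SkewPoly Θ) (i : ℕ) :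
    coeff (monomial k a * f) i = if k ≤ i then a * φ^[k] (coeff f (i - k)) else 0 := by
  induction f using SkewPolynomial.induction with
  | h0 => simp [iterate_map_zero]
  | ha m b f _ _ ih =>
    rw [mul_add, coeff_add, ih, monomial_mul_monomial, coeff_monomial, coeff_add, coeff_monomial]
    by_cases h : k ≤ i
    · by_cases h' : m = i - k
      · have : k + m = i := by omega
        simp [h, ← h', this, iterate_map_add, mul_add]
      · have : k + m ≠ i := by omega
        simp [h, h', this]
    · have : k + m ≠ i := by omega
      simp [h, this]

theorem coeff_C_mul (a : Coeff Θ) (f : SkewPoly Θ) (i : ℕ) :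
    coeff (C a * f) i = a * coeff f i := by
  simpa using coeff_monomial_mul 0 a f i

theorem coeff_mul_C (f : SkewPoly Θ) (a : Coeff Θ) (i : ℕ) :
    coeff (f * C a) i = coeff f i * φ^[i] a := by
  induction f using SkewPolynomial.induction with
  | h0 => simp
  | ha m b f _ _ ih =>
    rw [add_mul, coeff_add, ih, monomial_mul_C, coeff_monomial, coeff_add, coeff_monomial]
    split_ifs with h <;> simp [h, add_mul]

theorem coeff_mul (f g : SkewPoly Θ) (i : ℕ) :
    coeff (f * g) i =
      ∑ p ∈ Finset.HasAntidiagonal.antidiagonal i, coeff f p.1 * φ^[p.1] (coeff g p.2) := by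
  induction f using SkewPolynomial.induction with
  | h0 => simp
  | ha k a f _ _ ih =>
    simp only [add_mul, coeff_add, ih, Finset.sum_add_distrib]
    congr 1
    rw [coeff_monomial_mul]
    simp only [coeff_monomial]
    by_cases h : k ≤ i
    · rw [if_pos h]
      rw [Finset.sum_eq_single (k, i - k)]
      · simp
      · rintro ⟨p, q⟩ hp hne
        rw [Finset.HasAntidiagonal.mem_antidiagonal] at hp
        rw [if_neg, zero_mul]
        rintro rfl
        exact hne (by ext <;> simp at hp ⊢; omega)
      · intro hn
        exact absurd (by simp; omega) hn
    · rw [if_neg h, Finset.sum_eq_zero]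
      rintro ⟨p, q⟩ hp
      rw [Finset.HasAntidiagonal.mem_antidiagonal] at hp
      rw [if_neg (by simp at hp ⊢; omega), zero_mul]

theorem twist_injective (k : ℕ) : Function.Injective (φ^[k] : Coeff Θ → Coeff Θ) := by
  intro a b h
  rw [φ_iterate_apply, φ_iterate_apply] at h
  exact (Θ ^ k).injective h

/-- All coefficients of `f` from index `k` on vanish. -/
def VanishFrom (f : SkewPoly Θ) (k : ℕ) : Prop := ∀ i, k ≤ i → coeff f i = 0

/-- The skew polynomial `f` has degree `d` and leading coefficient `1`. -/
def MonicAt (f : SkewPoly Θ) (d : ℕ) : Prop := coeff f d = 1 ∧ VanishFrom f (d + 1)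

theorem VanishFrom.mono {f : SkewPoly Θ} {k l : ℕ} (h : VanishFrom f k) (hkl : k ≤ l) :
    VanishFrom f l := fun i hi => h i (hkl.trans hi)

theorem VanishFrom.eq_zero {f : SkewPoly Θ} (h : VanishFrom f 0) : f = 0 := by
  ext i
  simpa using h i (Nat.zero_le i)

theorem VanishFrom.zero (k : ℕ) : VanishFrom (0 : SkewPoly Θ) k := fun _ _ => rfl

theorem VanishFrom.add {f g : SkewPoly Θ} {k : ℕ} (hf : VanishFrom f k) (hg : VanishFrom g k) :
    VanishFrom (f + g) k := fun i hi => by rw [coeff_add, hf i hi, hg i hi, add_zero]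

theorem VanishFrom.sub {f g : SkewPoly Θ} {k : ℕ} (hf : VanishFrom f k) (hg : VanishFrom g k) :
    VanishFrom (f - g) k := fun i hi => by rw [coeff_sub, hf i hi, hg i hi, sub_zero]

theorem VanishFrom.C_mul {f : SkewPoly Θ} {k : ℕ} (hf : VanishFrom f k) (a : Coeff Θ) :
    VanishFrom (C a * f) k := fun i hi => by rw [coeff_C_mul, hf i hi, mul_zero]

theorem VanishFrom.mul_C {f : SkewPoly Θ} {k : ℕ} (hf : VanishFrom f k) (a : Coeff Θ) :
    VanishFrom (f * C a) k := fun i hi => by rw [coeff_mul_C, hf i hi, zero_mul]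

theorem VanishFrom.mul {f g : SkewPoly Θ} {k l : ℕ} (hf : VanishFrom f (k + 1))
    (hg : VanishFrom g l) : VanishFrom (f * g) (k + l) := by
  intro i hi
  rw [coeff_mul]
  refine Finset.sum_eq_zero fun p hp => ?_
  rw [Finset.HasAntidiagonal.mem_antidiagonal] at hp
  rcases Nat.lt_or_ge p.1 (k + 1) with h | h
  · rw [hg p.2 (by omega), iterate_map_zero, mul_zero]
  · rw [hf p.1 h, zero_mul]

theorem coeff_mul_top {f g : SkewPoly Θ} {k l : ℕ} (hf : VanishFrom f (k + 1))
    (hg : VanishFrom g (l + 1)) : coeff (f * g) (k + l) = coeff f k * φ^[k] (coeff g l) := by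
  rw [coeff_mul, Finset.sum_eq_single (k, l)]
  · intro p hp hne
    rw [Finset.HasAntidiagonal.mem_antidiagonal] at hp
    rcases Nat.lt_or_ge p.1 (k + 1) with h | h
    · rcases Nat.lt_or_ge p.2 (l + 1) with h' | h'
      · exact absurd (Prod.ext (by simp; omega) (by simp; omega)) hne
      · rw [hg p.2 h', iterate_map_zero, mul_zero]
    · rw [hf p.1 h, zero_mul]
  · intro h
    simp at h

theorem vanishFrom_natDegree_succ (f : SkewPoly Θ) : VanishFrom f (natDegree f + 1) := by
  intro i hi
  by_contra h
  have : i ≤ natDegree f := Finset.le_sup (f := id) (mem_support_iff.2 h)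
  omega

theorem coeff_natDegree_ne_zero {f : SkewPoly Θ} (hf : f ≠ 0) : coeff f (natDegree f) ≠ 0 := by
  rw [← mem_support_iff]
  have h : f.support.Nonempty := by
    rw [Finset.nonempty_iff_ne_empty]
    simpa using hf
  obtain ⟨i, hi, h'⟩ := Finset.exists_mem_eq_sup f.support h id
  rw [natDegree, h']
  exact hi

theorem natDegree_lt_of_vanishFrom {f : SkewPoly Θ} (hf : f ≠ 0) {k : ℕ} (h : VanishFrom f k) :
    natDegree f < k := by
  by_contra hk
  exact coeff_natDegree_ne_zero hf (h _ (not_lt.1 hk))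

theorem degree_lt_iff {f : SkewPoly Θ} {k : ℕ} : degree f < k ↔ VanishFrom f k := by
  rw [degree, Finset.max_eq_sup_withBot, Nat.cast_withBot,
    Finset.sup_lt_iff (WithBot.bot_lt_coe k)]
  simp only [mem_support_iff, VanishFrom, WithBot.coe_lt_coe]
  refine forall_congr' fun i => ⟨fun h hi => ?_, fun h h' => ?_⟩
  · by_contra hne
    exact absurd (h hne) (not_lt.2 hi)
  · by_contra hi
    exact h' (h (not_lt.1 hi))

theorem degree_le_natDegree (f : SkewPoly Θ) : degree f ≤ (natDegree f : ℕ) :=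
  Finset.max_le fun _ ha => WithBot.coe_le_coe.2 (Finset.le_sup (f := id) ha)

theorem degree_eq_natDegree {f : SkewPoly Θ} (hf : f ≠ 0) : degree f = (natDegree f : ℕ) :=
  le_antisymm (degree_le_natDegree f)
    (Finset.le_max (mem_support_iff.2 (coeff_natDegree_ne_zero hf)))

theorem degree_le_iff {f h : SkewPoly Θ} :
    degree f ≤ degree h ↔ ∀ k, VanishFrom h k → VanishFrom f k := by
  refine ⟨fun hle k hk => degree_lt_iff.1 (hle.trans_lt (degree_lt_iff.2 hk)), fun H => ?_⟩
  by_contra hlt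
  rw [not_le] at hlt
  have hf : f ≠ 0 := by
    rintro rfl
    exact not_lt_bot (show degree h < ⊥ from hlt)
  rw [degree_eq_natDegree hf, degree_lt_iff] at hlt
  exact coeff_natDegree_ne_zero hf (H _ hlt _ le_rfl)

theorem Monic.monicAt {f : SkewPoly Θ} (h : Monic f) : MonicAt f (natDegree f) :=
  ⟨h, vanishFrom_natDegree_succ f⟩

theorem MonicAt.natDegree_eq [Nontrivial R] {f : SkewPoly Θ} {d : ℕ} (h : MonicAt f d) :
    natDegree f = d := by
  have : Nontrivial (Coeff Θ) := inferInstanceAs (Nontrivial R)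
  have hf : f ≠ 0 := by
    rintro rfl
    simpa using h.1
  have h1 := natDegree_lt_of_vanishFrom hf h.2
  have h2 : d ≤ natDegree f :=
    Finset.le_sup (f := id) (mem_support_iff.2 (by rw [h.1]; exact one_ne_zero))
  omega

theorem MonicAt.monic [Nontrivial R] {f : SkewPoly Θ} {d : ℕ} (h : MonicAt f d) : Monic f := by
  rw [Monic, h.natDegree_eq, h.1]

theorem MonicAt.ne_zero [Nontrivial R] {f : SkewPoly Θ} {d : ℕ} (h : MonicAt f d) : f ≠ 0 := by
  have : Nontrivial (Coeff Θ) := inferInstanceAs (Nontrivial R)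
  rintro rfl
  simpa using h.1

/-- Although R has zero divisors, the leading coefficient of f survives multiplication by a monic
factor, so degrees add. This yields cancellation of monic factors. -/
theorem MonicAt.vanishFrom_left {f g : SkewPoly Θ} {d k : ℕ} (hg : MonicAt g d)
    (h : VanishFrom (f * g) (k + d)) : VanishFrom f k := by
  by_cases hf : f = 0
  · rw [hf]
    exact VanishFrom.zero k
  have key := coeff_mul_top (vanishFrom_natDegree_succ f) hg.2
  rw [hg.1, iterate_map_one, mul_one] at key
  have : natDegree f < k := by
    by_contra hk
    exact coeff_natDegree_ne_zero hf (key ▸ h _ (by omega))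
  exact (vanishFrom_natDegree_succ f).mono this

/-- On this side the leading coefficient of f gets twisted by Θᵈ, which is injective. -/
theorem MonicAt.vanishFrom_right {f g : SkewPoly Θ} {d k : ℕ} (hg : MonicAt g d)
    (h : VanishFrom (g * f) (d + k)) : VanishFrom f k := by
  by_cases hf : f = 0
  · rw [hf]
    exact VanishFrom.zero k
  have key := coeff_mul_top hg.2 (vanishFrom_natDegree_succ f)
  rw [hg.1, one_mul] at key
  have : natDegree f < k := by
    by_contra hk
    rw [h _ (by omega)] at key
    refine coeff_natDegree_ne_zero hf (twist_injective d ?_)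
    rw [← key, iterate_map_zero]
  exact (vanishFrom_natDegree_succ f).mono this

theorem MonicAt.mul_right_cancel {f f' g : SkewPoly Θ} {d : ℕ} (hg : MonicAt g d)
    (h : f * g = f' * g) : f = f' := by
  rw [← sub_eq_zero, ← sub_mul] at h
  exact sub_eq_zero.1 (hg.vanishFrom_left (k := 0) (by rw [h]; exact VanishFrom.zero _)).eq_zero

theorem MonicAt.mul_left_cancel {f f' g : SkewPoly Θ} {d : ℕ} (hg : MonicAt g d)
    (h : g * f = g * f') : f = f' := by
  rw [← sub_eq_zero, ← mul_sub] at h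
  exact sub_eq_zero.1 (hg.vanishFrom_right (k := 0) (by rw [h]; exact VanishFrom.zero _)).eq_zero

/-- Right division by a monic skew polynomial, inside a subring that is closed under taking
the monomials of its elements. -/
theorem MonicAt.exists_div_mod {g : SkewPoly Θ} {d : ℕ} (hg : MonicAt g d)
    (A : Subring (SkewPoly Θ)) (hA : ∀ f ∈ A, ∀ i j, monomial j (coeff f i) ∈ A) (hgA : g ∈ A)
    {f : SkewPoly Θ} (hf : f ∈ A) :
    ∃ q ∈ A, ∃ r ∈ A, f = q * g + r ∧ VanishFrom r d := by
  suffices H : ∀ k, ∀ f ∈ A, VanishFrom f (k + d) →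
      ∃ q ∈ A, ∃ r ∈ A, f = q * g + r ∧ VanishFrom r d from
    H (natDegree f + 1) f hf ((vanishFrom_natDegree_succ f).mono (by omega))
  intro k
  induction k with
  | zero => exact fun f hf h => ⟨0, A.zero_mem, f, hf, by simp, by simpa using h⟩
  | succ k ih =>
    intro f hf h
    have hm := hA f hf (k + d) k
    -- The twist fixes the leading coefficient 1 of g, so this multiple of g cancels the top term of
    -- f.
    obtain ⟨q, hq, r, hr, he, hv⟩ := ih (f - monomial k (coeff f (k + d)) * g)
      (A.sub_mem hf (A.mul_mem hm hgA)) (by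
        intro i hi
        rw [coeff_sub, coeff_monomial_mul, if_pos (by omega)]
        rcases hi.eq_or_lt with rfl | hi
        · rw [Nat.add_sub_cancel_left, hg.1, iterate_map_one, mul_one, sub_self]
        · rw [h i (by omega), hg.2 (i - k) (by omega), iterate_map_zero, mul_zero, sub_zero])
    refine ⟨q + monomial k (coeff f (k + d)), A.add_mem hq hm, r, hr, ?_, hv⟩
    rw [add_mul, add_right_comm, ← he]
    abel

theorem MonicAt.exists_div_mod' {g : SkewPoly Θ} {d : ℕ} (hg : MonicAt g d) (f : SkewPoly Θ) :
    ∃ q r, f = q * g + r ∧ VanishFrom r d := by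
  obtain ⟨q, -, r, -, h⟩ := hg.exists_div_mod ⊤ (fun _ _ _ _ => trivial) trivial
    (f := f) trivial
  exact ⟨q, r, h⟩

/-! ### Centrality of xⁿ - λ and words as residue classes -/

variable {n : ℕ} {lam : R}

theorem twist_apply (k : ℕ) (a : Coeff Θ) :
    φ^[k] a = toCoeff Θ ((Θ ^ k) ((toCoeff Θ).symm a)) := by
  rw [φ_iterate_apply]
  rfl

theorem toCoeff_symm_twist (k : ℕ) (a : Coeff Θ) :
    (toCoeff Θ).symm (φ^[k] a) = (Θ ^ k) ((toCoeff Θ).symm a) := by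
  rw [twist_apply, RingEquiv.symm_apply_apply]

theorem twist_eq_self (hΘ : orderOf Θ ∣ n) (a : Coeff Θ) : φ^[n] a = a := by
  rw [twist_apply, orderOf_dvd_iff_pow_eq_one.1 hΘ]
  simp

theorem C_mul_comm_of_fixed {a : R} (ha : Θ a = a) (f : SkewPoly Θ) :
    C (toCoeff Θ a) * f = f * C (toCoeff Θ a) := by
  ext i
  have h : ∀ i : ℕ, (Θ ^ i) a = a := by
    intro i
    induction i with
    | zero => simp
    | succ i ih => rw [pow_succ, RingAut.mul_apply, ha, ih]
  rw [coeff_C_mul, coeff_mul_C, twist_apply, RingEquiv.symm_apply_apply, h, mul_comm]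

theorem fixed_of_sign (hlam : lam = 1 ∨ lam = -1) : Θ lam = lam := by
  rcases hlam with rfl | rfl <;> simp

theorem mul_self_of_sign (hlam : lam = 1 ∨ lam = -1) : lam * lam = 1 := by
  rcases hlam with rfl | rfl <;> simp

theorem modulus_mul_comm (hΘ : orderOf Θ ∣ n) (hlam : lam = 1 ∨ lam = -1) (f : SkewPoly Θ) :
    modulus Θ n lam * f = f * modulus Θ n lam := by
  rw [modulus, sub_mul, mul_sub, C_mul_comm_of_fixed (fixed_of_sign hlam)]
  congr 1
  induction f using SkewPolynomial.induction with
  | h0 => simp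
  | ha k a f _ _ ih =>
    rw [mul_add, add_mul, ih, X_pow_mul_monomial, monomial_mul_X_pow, twist_eq_self hΘ]

theorem monicAt_modulus (hn : 0 < n) : MonicAt (modulus Θ n lam) n := by
  have h : ∀ i, coeff (modulus Θ n lam) i =
      (if n = i then 1 else 0) - if i = 0 then toCoeff Θ lam else 0 := fun i => by
    rw [modulus, coeff_sub, X_pow_eq_monomial, coeff_monomial, coeff_C]
  refine ⟨?_, fun i hi => ?_⟩
  · rw [h, if_pos rfl, if_neg hn.ne', sub_zero]
  · rw [h, if_neg (by omega), if_neg (by omega), sub_zero]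

theorem mk_modulus : mk Θ n lam (modulus Θ n lam) = 0 := by
  rw [← TwoSidedIdeal.mem_ker, mk, TwoSidedIdeal.ker_ringCon_mk']
  exact TwoSidedIdeal.subset_span rfl

theorem mk_surjective : Function.Surjective (mk Θ n lam) := RingCon.mk'_surjective _

/-- Centrality of the modulus makes its left multiples a two-sided ideal. -/
theorem mk_eq_zero_iff (hΘ : orderOf Θ ∣ n) (hlam : lam = 1 ∨ lam = -1) {f : SkewPoly Θ} :
    mk Θ n lam f = 0 ↔ ∃ d, f = d * modulus Θ n lam := by
  refine ⟨fun h => ?_, ?_⟩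
  · rw [← TwoSidedIdeal.mem_ker, mk, TwoSidedIdeal.ker_ringCon_mk'] at h
    induction h using TwoSidedIdeal.span_induction with
    | mem x hx => exact ⟨1, by rw [one_mul]; exact hx⟩
    | zero => exact ⟨0, by rw [zero_mul]⟩
    | add x y _ _ hx hy =>
      obtain ⟨a, rfl⟩ := hx
      obtain ⟨b, rfl⟩ := hy
      exact ⟨a + b, by rw [add_mul]⟩
    | neg x _ hx =>
      obtain ⟨a, rfl⟩ := hx
      exact ⟨-a, by rw [neg_mul]⟩
    | left_absorb a x _ hx =>
      obtain ⟨b, rfl⟩ := hx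
      exact ⟨a * b, by rw [mul_assoc]⟩
    | right_absorb a x _ hx =>
      obtain ⟨b, rfl⟩ := hx
      exact ⟨b * a, by rw [mul_assoc, mul_assoc, modulus_mul_comm hΘ hlam]⟩
  · rintro ⟨d, rfl⟩
    rw [map_mul, mk_modulus, mul_zero]

theorem mk_X_pow : mk Θ n lam X ^ n = mk Θ n lam (C (toCoeff Θ lam)) := by
  rw [← map_pow, ← sub_eq_zero, ← map_sub]
  exact mk_modulus

theorem coeff_wordPoly (c : Fin n → R) (i : ℕ) :
    coeff (wordPoly Θ c) i = if h : i < n then toCoeff Θ (c ⟨i, h⟩) else 0 := by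
  have : coeff (wordPoly Θ c) i =
      ∑ j : Fin n, coeff (monomial (j : ℕ) (toCoeff Θ (c j))) i := by
    let e : SkewPoly Θ →+ Coeff Θ := ⟨⟨fun f => coeff f i, rfl⟩, fun f g => coeff_add f g i⟩
    exact map_sum e _ _
  rw [this]
  simp only [coeff_monomial]
  split_ifs with h
  · rw [Finset.sum_eq_single ⟨i, h⟩]
    · simp
    · intro j _ hj
      rw [if_neg]
      rintro rfl
      exact hj rfl
    · simp
  · exact Finset.sum_eq_zero fun j _ => if_neg (by have := j.2; omega)

theorem vanishFrom_wordPoly (c : Fin n → R) : VanishFrom (wordPoly Θ c) n := fun i hi => by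
  rw [coeff_wordPoly, dif_neg (by omega)]

theorem wordPoly_coeff {f : SkewPoly Θ} (h : VanishFrom f n) :
    wordPoly Θ (fun i : Fin n => (toCoeff Θ).symm (coeff f i)) = f := by
  ext i
  rw [coeff_wordPoly]
  split_ifs with hi
  · simp
  · exact (h i (by omega)).symm

theorem exists_wordPoly (hn : 0 < n) (s : SkewQuot Θ n lam) :
    ∃ c : Fin n → R, mk Θ n lam (wordPoly Θ c) = s := by
  obtain ⟨f, rfl⟩ := mk_surjective s
  obtain ⟨q, r, rfl, hr⟩ := (monicAt_modulus (Θ := Θ) (lam := lam) hn).exists_div_mod' f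
  exact ⟨_, by rw [wordPoly_coeff hr, map_add, map_mul, mk_modulus, mul_zero, zero_add]⟩

theorem eq_zero_of_mk_eq_zero (hn : 0 < n) (hΘ : orderOf Θ ∣ n) (hlam : lam = 1 ∨ lam = -1)
    {f : SkewPoly Θ} (hf : VanishFrom f n) (h : mk Θ n lam f = 0) : f = 0 := by
  obtain ⟨d, rfl⟩ := (mk_eq_zero_iff hΘ hlam).1 h
  rw [((monicAt_modulus hn).vanishFrom_left (f := d) (k := 0) (by simpa using hf)).eq_zero, zero_mul]

/-! ### The quotient as a quotient of the skew Laurent polynomial ring -/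

theorem mk_X_mul_mk_C (a : Coeff Θ) :
    mk Θ n lam X * mk Θ n lam (C a) = mk Θ n lam (C (φ a)) * mk Θ n lam X := by
  rw [← map_mul, ← map_mul, X_mul, sum_C_index (by simp), monomial_zero_left]

/-- The residue class of `x` is a unit. -/
def unitX (hn : 0 < n) (hlam : lam = 1 ∨ lam = -1) : (SkewQuot Θ n lam)ˣ where
  val := mk Θ n lam X
  -- λxⁿ⁻¹ · x = λxⁿ = λ² = 1.
  inv := mk Θ n lam (C (toCoeff Θ lam)) * mk Θ n lam X ^ (n - 1)
  val_inv := by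
    rw [← mul_assoc, ← map_mul, ← C_mul_comm_of_fixed (fixed_of_sign hlam), map_mul, mul_assoc,
      ← pow_succ', Nat.sub_add_cancel hn, mk_X_pow, ← map_mul, ← C_mul, ← map_mul,
      mul_self_of_sign hlam, map_one, C_1, map_one]
  inv_val := by
    rw [mul_assoc, ← pow_succ, Nat.sub_add_cancel hn, mk_X_pow, ← map_mul, ← C_mul, ← map_mul,
      mul_self_of_sign hlam, map_one, C_1, map_one]

theorem coe_unitX (hn : 0 < n) (hlam : lam = 1 ∨ lam = -1) :
    (unitX (Θ := Θ) hn hlam : SkewQuot Θ n lam) = mk Θ n lam X := rfl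

/-- This is the relation needed to extend the residue class map to skew Laurent polynomials. -/
theorem unitX_zpow_mul_mk_C (hn : 0 < n) (hlam : lam = 1 ∨ lam = -1) (k : ℤ) (a : R) :
    ((unitX (Θ := Θ) hn hlam ^ k : (SkewQuot Θ n lam)ˣ) : SkewQuot Θ n lam) *
        mk Θ n lam (C (toCoeff Θ a)) =
      mk Θ n lam (C (toCoeff Θ ((Θ ^ k) a))) *
        ((unitX (Θ := Θ) hn hlam ^ k : (SkewQuot Θ n lam)ˣ) : SkewQuot Θ n lam) := by
  have hX : ∀ b : R, (unitX (Θ := Θ) hn hlam : SkewQuot Θ n lam) * mk Θ n lam (C (toCoeff Θ b)) =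
      mk Θ n lam (C (toCoeff Θ (Θ b))) * (unitX (Θ := Θ) hn hlam : SkewQuot Θ n lam) := by
    intro b
    rw [coe_unitX, mk_X_mul_mk_C]
    congr 3
  have hXi : ∀ b : R, (↑(unitX (Θ := Θ) hn hlam)⁻¹ : SkewQuot Θ n lam) *
      mk Θ n lam (C (toCoeff Θ b)) =
      mk Θ n lam (C (toCoeff Θ (Θ⁻¹ b))) * (↑(unitX (Θ := Θ) hn hlam)⁻¹ : SkewQuot Θ n lam) := by
    intro b
    rw [Units.inv_mul_eq_iff_eq_mul, ← mul_assoc, hX, mul_assoc, Units.mul_inv, mul_one]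
    congr 3
    exact (Θ.apply_symm_apply b).symm
  induction k using Int.induction_on generalizing a with
  | zero => simp
  | succ k ih =>
    rw [zpow_add_one, zpow_add_one, Units.val_mul, mul_assoc, hX, ← mul_assoc, ih, mul_assoc]
    rfl
  | pred k ih =>
    rw [zpow_sub_one, zpow_sub_one, Units.val_mul, mul_assoc, hXi, ← mul_assoc, ih, mul_assoc]
    rfl

/-- The residue class map from the skew Laurent polynomial ring to the quotient. -/
def laurentMk (hn : 0 < n) (hlam : lam = 1 ∨ lam = -1) : SkewLaurent Θ →+* SkewQuot Θ n lam :=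
  SkewMonoidAlgebra.liftNCRingHom ((mk Θ n lam).comp CRingHom)
    ((Units.coeHom _).comp (zpowersHom _ (unitX hn hlam)))
    (fun {a k} => (unitX_zpow_mul_mk_C hn hlam k.toAdd ((toCoeff Θ).symm a)).symm)

theorem laurentMk_single (hn : 0 < n) (hlam : lam = 1 ∨ lam = -1) (k : ℤ) (a : Coeff Θ) :
    laurentMk hn hlam (SkewMonoidAlgebra.single (Multiplicative.ofAdd k) a) =
      mk Θ n lam (C a) * ((unitX (Θ := Θ) hn hlam ^ k : (SkewQuot Θ n lam)ˣ) : SkewQuot Θ n lam) :=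
  SkewMonoidAlgebra.liftNC_single _ _ _ _

theorem laurentMk_xPow (hn : 0 < n) (hlam : lam = 1 ∨ lam = -1) (k : ℤ) :
    laurentMk hn hlam (xPow Θ k) =
      ((unitX (Θ := Θ) hn hlam ^ k : (SkewQuot Θ n lam)ˣ) : SkewQuot Θ n lam) := by
  rw [xPow, laurentMk_single, C_1, map_one, one_mul]

theorem laurentMk_constL (hn : 0 < n) (hlam : lam = 1 ∨ lam = -1) (a : Coeff Θ) :
    laurentMk hn hlam (constL a) = mk Θ n lam (C a) := by
  refine (laurentMk_single hn hlam 0 a).trans ?_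
  rw [zpow_zero, Units.val_one, mul_one]

theorem laurentMk_toLaurent (hn : 0 < n) (hlam : lam = 1 ∨ lam = -1) (f : SkewPoly Θ) :
    laurentMk hn hlam (toLaurent f) = mk Θ n lam f := by
  conv_rhs => rw [← sum_monomial f]
  rw [toLaurent, sum_def, sum_def, map_sum, map_sum]
  refine Finset.sum_congr rfl fun i _ => ?_
  rw [map_mul, laurentMk_constL, laurentMk_xPow, zpow_natCast, Units.val_pow_eq_pow_val,
    coe_unitX, ← map_pow, ← map_mul, C_mul_X_pow_eq_monomial]

/-- The additive map `toLaurent`. -/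
def toLaurentHom : SkewPoly Θ →+ SkewLaurent Θ where
  toFun := toLaurent
  map_zero' := sum_zero_index _
  map_add' f g := sum_add_index f g _
    (fun i => by simp [constL])
    (fun i a b => by simp only [constL, SkewMonoidAlgebra.single_add, add_mul])

theorem xPow_mul_xPow (k l : ℤ) : xPow Θ k * xPow Θ l = xPow Θ (k + l) := by
  rw [xPow, xPow, SkewMonoidAlgebra.single_mul_single, smul_one, mul_one]
  rfl

theorem toLaurent_X_pow_mul_C (k : ℕ) (a : Coeff Θ) :
    toLaurent (X ^ k * C a) = xPow Θ k * constL a := by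
  rw [← monomial_zero_left, X_pow_mul_monomial, zero_add, toLaurent,
    sum_monomial_index (by simp [constL]), xPow, constL, constL,
    SkewMonoidAlgebra.single_mul_single, SkewMonoidAlgebra.single_mul_single, one_smul, mul_one,
    one_mul, one_mul, mul_one, φ_iterate_apply]
  rfl

/-- Each term xᵏx⁻ⁱaᵢ has a nonnegative exponent; this is why the displayed generators of the dual
lie in R[x; Θ]. -/
theorem exists_toLaurent_eq {f : SkewPoly Θ} {k : ℤ} (hf : ∀ i : ℕ, coeff f i ≠ 0 → (i : ℤ) ≤ k) :
    ∃ P : SkewPoly Θ, toLaurent P = xPow Θ k * antiMap f := by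
  refine ⟨f.sum fun i a => X ^ (k - i).toNat * C a, ?_⟩
  rw [sum_def, antiMap, sum_def, Finset.mul_sum]
  refine (map_sum toLaurentHom _ _).trans (Finset.sum_congr rfl fun i hi => ?_)
  refine (toLaurent_X_pow_mul_C _ _).trans ?_
  rw [← mul_assoc, xPow_mul_xPow,
    Int.toNat_of_nonneg (sub_nonneg.2 (hf i (mem_support_iff.1 hi))), sub_eq_add_neg]

theorem exists_toLaurent_eq_of_vanishFrom {f : SkewPoly Θ} {d : ℕ} (hd : d ≤ n)
    (hf : VanishFrom f (n - d + 1)) :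
    ∃ P : SkewPoly Θ, toLaurent P = xPow Θ ((n : ℤ) - d) * antiMap f := by
  refine exists_toLaurent_eq fun i hi => ?_
  by_contra h
  exact hi (hf i (by omega))

/-! ### The anti-automorphism of the quotient and the Euclidean dual -/

open MulOpposite in
/-- The anti-homomorphism `∑ aᵢ xⁱ ↦ ∑ x⁻ⁱ aᵢ` from `R[x; Θ]` to the quotient. -/
def antiHomAux (hn : 0 < n) (hlam : lam = 1 ∨ lam = -1) :
    SkewPoly Θ →+* (SkewQuot Θ n lam)ᵐᵒᵖ :=
  SkewMonoidAlgebra.liftNCRingHom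
    (((mk Θ n lam).comp CRingHom).toOpposite fun a b => by
      rw [commute_iff_eq, ← map_mul, ← map_mul, mul_comm])
    (powersHom _ (op (↑(unitX (Θ := Θ) hn hlam)⁻¹ : SkewQuot Θ n lam)))
    (fun {a k} => by
      -- In the opposite ring the relation xᵏa = Θᵏ(a)xᵏ turns into a x⁻ᵏ = x⁻ᵏΘᵏ(a), which is the
      -- commutation rule for the exponent -k.
      have h := unitX_zpow_mul_mk_C (Θ := Θ) hn hlam (-(k.toAdd : ℤ))
        ((toCoeff Θ).symm (k • a))
      have h' : (Θ ^ (-(k.toAdd : ℤ))) ((toCoeff Θ).symm (k • a)) = (toCoeff Θ).symm a := by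
        rw [zpow_neg, zpow_natCast]
        exact (Θ ^ k.toAdd).symm_apply_apply _
      rw [h', RingEquiv.apply_symm_apply, RingEquiv.apply_symm_apply, zpow_neg, zpow_natCast,
        ← inv_pow, Units.val_pow_eq_pow_val] at h
      apply unop_injective
      simpa [powersHom_apply] using! h)

open MulOpposite in
theorem antiHomAux_monomial (hn : 0 < n) (hlam : lam = 1 ∨ lam = -1) (i : ℕ) (a : Coeff Θ) :
    antiHomAux (Θ := Θ) hn hlam (monomial i a) =
      op ((↑(unitX (Θ := Θ) hn hlam)⁻¹ : SkewQuot Θ n lam) ^ i * mk Θ n lam (C a)) :=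
  SkewMonoidAlgebra.liftNC_single _ _ _ _

theorem unop_antiHomAux (hn : 0 < n) (hlam : lam = 1 ∨ lam = -1) (f : SkewPoly Θ) :
    (antiHomAux hn hlam f).unop = laurentMk hn hlam (antiMap f) := by
  conv_lhs => rw [← sum_monomial f]
  rw [antiMap, sum_def, sum_def, map_sum, map_sum, Finset.unop_sum]
  refine Finset.sum_congr rfl fun i _ => ?_
  rw [antiHomAux_monomial, map_mul, laurentMk_constL, laurentMk_xPow, zpow_neg, zpow_natCast,
    ← inv_pow, Units.val_pow_eq_pow_val, MulOpposite.unop_op]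

theorem unitX_inv_pow (hn : 0 < n) (hlam : lam = 1 ∨ lam = -1) :
    (↑(unitX (Θ := Θ) hn hlam)⁻¹ : SkewQuot Θ n lam) ^ n = mk Θ n lam (C (toCoeff Θ lam)) := by
  rw [← Units.val_pow_eq_pow_val, inv_pow, Units.inv_eq_of_mul_eq_one_right]
  rw [Units.val_pow_eq_pow_val, coe_unitX, mk_X_pow, ← map_mul, ← C_mul, ← map_mul,
      mul_self_of_sign hlam, map_one, C_1, map_one]

/-- The image is x⁻ⁿ - λ, which vanishes because λ⁻¹ = λ. Hence the anti-homomorphism descends to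
the quotient. -/
theorem antiHomAux_modulus (hn : 0 < n) (hlam : lam = 1 ∨ lam = -1) :
    antiHomAux hn hlam (modulus Θ n lam) = 0 := by
  refine (map_sub (antiHomAux hn hlam) (X ^ n) (C (toCoeff Θ lam))).trans ?_
  rw [X_pow_eq_monomial, ← monomial_zero_left, antiHomAux_monomial,
    antiHomAux_monomial, unitX_inv_pow, C_1, map_one, mul_one, pow_zero, one_mul, sub_self]

/-- The anti-automorphism `∑ aᵢ xⁱ ↦ ∑ x⁻ⁱ aᵢ` of the quotient. -/
def antiHom (hn : 0 < n) (hlam : lam = 1 ∨ lam = -1) :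
    SkewQuot Θ n lam →+* (SkewQuot Θ n lam)ᵐᵒᵖ :=
  RingCon.lift _ (antiHomAux hn hlam) (by
    have h : TwoSidedIdeal.span {modulus Θ n lam} ≤ TwoSidedIdeal.ker (antiHomAux hn hlam) := by
      rw [TwoSidedIdeal.span_le, Set.singleton_subset_iff, SetLike.mem_coe, TwoSidedIdeal.mem_ker,
        antiHomAux_modulus]
    exact TwoSidedIdeal.ringCon_le_iff.1 h)

theorem antiHom_mk (hn : 0 < n) (hlam : lam = 1 ∨ lam = -1) (f : SkewPoly Θ) :
    antiHom hn hlam (mk Θ n lam f) = antiHomAux hn hlam f := rfl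

/-- The anti-automorphism of the quotient, as a map. -/
def anti (hn : 0 < n) (hlam : lam = 1 ∨ lam = -1) (s : SkewQuot Θ n lam) : SkewQuot Θ n lam :=
  (antiHom hn hlam s).unop

theorem anti_mul (hn : 0 < n) (hlam : lam = 1 ∨ lam = -1) (s t : SkewQuot Θ n lam) :
    anti hn hlam (s * t) = anti hn hlam t * anti hn hlam s := by
  rw [anti, map_mul, MulOpposite.unop_mul]
  rfl

theorem anti_add (hn : 0 < n) (hlam : lam = 1 ∨ lam = -1) (s t : SkewQuot Θ n lam) :
    anti hn hlam (s + t) = anti hn hlam s + anti hn hlam t := by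
  rw [anti, map_add, MulOpposite.unop_add]
  rfl

theorem anti_zero (hn : 0 < n) (hlam : lam = 1 ∨ lam = -1) :
    anti (Θ := Θ) hn hlam 0 = 0 := by
  rw [anti, map_zero, MulOpposite.unop_zero]

theorem anti_mk_C (hn : 0 < n) (hlam : lam = 1 ∨ lam = -1) (a : Coeff Θ) :
    anti hn hlam (mk Θ n lam (C a)) = mk Θ n lam (C a) := by
  rw [anti, antiHom_mk, ← monomial_zero_left, antiHomAux_monomial, pow_zero, one_mul]
  rfl

theorem anti_unitX (hn : 0 < n) (hlam : lam = 1 ∨ lam = -1) :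
    anti hn hlam (unitX (Θ := Θ) hn hlam : SkewQuot Θ n lam) =
      (↑(unitX (Θ := Θ) hn hlam)⁻¹ : SkewQuot Θ n lam) := by
  rw [coe_unitX, anti, antiHom_mk, ← monomial_one_one_eq_X, antiHomAux_monomial, C_1, map_one,
    mul_one, pow_one, MulOpposite.unop_op]

theorem anti_unitX_pow (hn : 0 < n) (hlam : lam = 1 ∨ lam = -1) (k : ℕ) :
    anti hn hlam ((unitX (Θ := Θ) hn hlam : SkewQuot Θ n lam) ^ k) =
      (↑(unitX (Θ := Θ) hn hlam)⁻¹ : SkewQuot Θ n lam) ^ k := by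
  rw [anti, map_pow, MulOpposite.unop_pow]
  exact congrArg (· ^ k) (anti_unitX hn hlam)

theorem anti_unitX_inv (hn : 0 < n) (hlam : lam = 1 ∨ lam = -1) :
    anti hn hlam (↑(unitX (Θ := Θ) hn hlam)⁻¹ : SkewQuot Θ n lam) =
      (unitX (Θ := Θ) hn hlam : SkewQuot Θ n lam) := by
  have h := anti_mul hn hlam (unitX (Θ := Θ) hn hlam : SkewQuot Θ n lam)
    (↑(unitX (Θ := Θ) hn hlam)⁻¹ : SkewQuot Θ n lam)
  rw [Units.mul_inv, anti_unitX, Units.eq_mul_inv_iff_mul_eq] at h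
  rw [← h, anti, map_one, MulOpposite.unop_one, one_mul]

theorem anti_anti (hn : 0 < n) (hlam : lam = 1 ∨ lam = -1) (s : SkewQuot Θ n lam) :
    anti hn hlam (anti hn hlam s) = s := by
  obtain ⟨f, rfl⟩ := mk_surjective s
  induction f using SkewPolynomial.induction with
  | h0 => rw [map_zero, anti_zero, anti_zero]
  | ha i a f _ _ ih =>
    rw [map_add, anti_add, anti_add, ih, ← C_mul_X_pow_eq_monomial, map_mul, map_pow,
      ← coe_unitX hn hlam, anti_mul, anti_mul, anti_mk_C, anti_mk_C, anti_unitX_pow, anti, map_pow, MulOpposite.unop_pow]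
    congr 3
    exact anti_unitX_inv hn hlam

/-- Links the generators formed in the Laurent ring to the anti-automorphism: they agree up to the
unit xᵏ. -/
theorem mk_eq_of_toLaurent_eq (hn : 0 < n) (hlam : lam = 1 ∨ lam = -1) {f P : SkewPoly Θ} {k : ℤ}
    (h : toLaurent P = xPow Θ k * antiMap f) :
    mk Θ n lam P = ((unitX (Θ := Θ) hn hlam ^ k : (SkewQuot Θ n lam)ˣ) : SkewQuot Θ n lam) *
      anti hn hlam (mk Θ n lam f) := by
  rw [← laurentMk_toLaurent hn hlam, h, map_mul, laurentMk_xPow, anti, antiHom_mk,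
    unop_antiHomAux]

theorem wordPoly_add (c d : Fin n → R) : wordPoly Θ (c + d) = wordPoly Θ c + wordPoly Θ d := by
  simp only [wordPoly, Pi.add_apply, map_add, Finset.sum_add_distrib]

/-- Words of length `n` as elements of the quotient. -/
def wordEquiv (hn : 0 < n) (hΘ : orderOf Θ ∣ n) (hlam : lam = 1 ∨ lam = -1) :
    (Fin n → R) ≃+ SkewQuot Θ n lam :=
  AddEquiv.ofBijective
    (AddMonoidHom.mk' (fun c => mk Θ n lam (wordPoly Θ c)) fun c d => by
      rw [wordPoly_add, map_add])
    ⟨by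
      rw [injective_iff_map_eq_zero]
      intro c hc
      have h := eq_zero_of_mk_eq_zero hn hΘ hlam (vanishFrom_wordPoly c) hc
      ext i
      have hi := coeff_wordPoly (Θ := Θ) c i
      rw [h, coeff_zero, dif_pos i.2] at hi
      exact hi.symm, exists_wordPoly hn⟩

/-- The constant coefficient of an element of the quotient. -/
def constTerm (hn : 0 < n) (hΘ : orderOf Θ ∣ n) (hlam : lam = 1 ∨ lam = -1) :
    SkewQuot Θ n lam →+ R :=
  (Pi.evalAddMonoidHom (fun _ : Fin n => R) ⟨0, hn⟩).comp
    (wordEquiv hn hΘ hlam).symm.toAddMonoidHom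

theorem constTerm_mk (hn : 0 < n) (hΘ : orderOf Θ ∣ n) (hlam : lam = 1 ∨ lam = -1)
    {f : SkewPoly Θ} (hf : VanishFrom f n) :
    constTerm hn hΘ hlam (mk Θ n lam f) = (toCoeff Θ).symm (coeff f 0) := by
  have h : (wordEquiv hn hΘ hlam).symm (mk Θ n lam f) =
      fun i : Fin n => (toCoeff Θ).symm (coeff f i) := by
    rw [AddEquiv.symm_apply_eq]
    exact congrArg _ (wordPoly_coeff hf).symm
  exact congrFun h ⟨0, hn⟩

theorem vanishFrom_monomial {k l : ℕ} (h : k < l) (a : Coeff Θ) : VanishFrom (monomial k a) l :=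
  fun i hi => by rw [coeff_monomial, if_neg (by omega)]

/-- The range -n < k < n is that of differences of two positions in a word. -/
theorem constTerm_mk_C_mul_zpow (hn : 0 < n) (hΘ : orderOf Θ ∣ n) (hlam : lam = 1 ∨ lam = -1)
    (a : R) {k : ℤ} (hk : -(n : ℤ) < k) (hk' : k < n) :
    constTerm hn hΘ hlam (mk Θ n lam (C (toCoeff Θ a)) *
      ((unitX (Θ := Θ) hn hlam ^ k : (SkewQuot Θ n lam)ˣ) : SkewQuot Θ n lam)) =
      if k = 0 then a else 0 := by
  have key : ∀ (b : Coeff Θ) (j : ℕ), j < n → constTerm hn hΘ hlam (mk Θ n lam (C b) *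
      ((unitX (Θ := Θ) hn hlam ^ j : (SkewQuot Θ n lam)ˣ) : SkewQuot Θ n lam)) =
      if j = 0 then (toCoeff Θ).symm b else 0 := by
    intro b j hj
    rw [Units.val_pow_eq_pow_val, coe_unitX, ← map_pow, ← map_mul, C_mul_X_pow_eq_monomial,
      constTerm_mk hn hΘ hlam (vanishFrom_monomial hj b), coeff_monomial]
    split_ifs <;> simp
  rcases le_or_gt 0 k with h0 | h0
  · obtain ⟨j, rfl⟩ := Int.eq_ofNat_of_zero_le h0
    rw [zpow_natCast, key _ j (by omega)]
    simp
  -- For negative k, xᵏ = x⁻ⁿxᵏ⁺ⁿ = λxᵏ⁺ⁿ with 0 < k + n < n.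
  · obtain ⟨j, hj⟩ := Int.eq_ofNat_of_zero_le (show 0 ≤ k + n by omega)
    have hk : k = -(n : ℤ) + j := by omega
    rw [hk, zpow_add, zpow_neg, zpow_natCast, zpow_natCast, ← inv_pow, Units.val_mul,
      Units.val_pow_eq_pow_val, unitX_inv_pow, ← mul_assoc, ← map_mul, ← C_mul, key _ j (by omega),
      if_neg (by omega), if_neg (by omega)]

theorem mk_wordPoly (hn : 0 < n) (hlam : lam = 1 ∨ lam = -1) (c : Fin n → R) :
    mk Θ n lam (wordPoly Θ c) = ∑ i : Fin n, mk Θ n lam (C (toCoeff Θ (c i))) *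
      ((unitX (Θ := Θ) hn hlam ^ (i : ℤ) : (SkewQuot Θ n lam)ˣ) : SkewQuot Θ n lam) := by
  rw [wordPoly, map_sum]
  refine Finset.sum_congr rfl fun i _ => ?_
  rw [zpow_natCast, Units.val_pow_eq_pow_val, coe_unitX, ← map_pow, ← map_mul,
    C_mul_X_pow_eq_monomial]

theorem anti_mk_wordPoly (hn : 0 < n) (hlam : lam = 1 ∨ lam = -1) (c : Fin n → R) :
    anti hn hlam (mk Θ n lam (wordPoly Θ c)) = ∑ i : Fin n,
      ((unitX (Θ := Θ) hn hlam ^ (-(i : ℤ)) : (SkewQuot Θ n lam)ˣ) : SkewQuot Θ n lam) *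
        mk Θ n lam (C (toCoeff Θ (c i))) := by
  rw [mk_wordPoly hn hlam, anti, map_sum, Finset.unop_sum]
  refine Finset.sum_congr rfl fun i _ => ?_
  refine (anti_mul hn hlam _ _).trans ?_
  rw [anti_mk_C, zpow_natCast, Units.val_pow_eq_pow_val, anti_unitX_pow, zpow_neg, zpow_natCast,
    ← inv_pow, Units.val_pow_eq_pow_val]

/-- The product is the sum of the terms vᵢxⁱ⁻ʲcⱼ, and only those with i = j have a constant part. -/
theorem constTerm_mul_anti (hn : 0 < n) (hΘ : orderOf Θ ∣ n) (hlam : lam = 1 ∨ lam = -1)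
    (v c : Fin n → R) :
    constTerm hn hΘ hlam (mk Θ n lam (wordPoly Θ v) * anti hn hlam (mk Θ n lam (wordPoly Θ c))) =
      ∑ i, v i * c i := by
  rw [mk_wordPoly hn hlam, anti_mk_wordPoly, Finset.sum_mul_sum, map_sum]
  refine Finset.sum_congr rfl fun i _ => ?_
  rw [map_sum, Finset.sum_eq_single i]
  · rw [mul_assoc, ← mul_assoc (Units.val _), ← Units.val_mul, ← zpow_add, add_neg_cancel, zpow_zero,
      Units.val_one, one_mul, ← map_mul, ← C_mul, ← map_mul]
    simpa using constTerm_mk_C_mul_zpow hn hΘ hlam (v i * c i) (k := 0) (by omega) (by omega)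
  · intro j _ hj
    have hij : (i : ℤ) + -(j : ℤ) ≠ 0 := fun h => hj (Fin.ext (by omega))
    have hi := i.2
    have hj := j.2
    rw [mul_assoc, ← mul_assoc (Units.val _), ← Units.val_mul, ← zpow_add, unitX_zpow_mul_mk_C,
      ← mul_assoc, ← map_mul, ← C_mul, ← map_mul, constTerm_mk_C_mul_zpow hn hΘ hlam _
      (by omega) (by omega), if_neg hij]
  · simp

/-- Multiplication by x⁻ʲ moves the j-th coefficient into the constant term. -/
theorem eq_zero_of_constTerm (hn : 0 < n) (hΘ : orderOf Θ ∣ n) (hlam : lam = 1 ∨ lam = -1)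
    {s : SkewQuot Θ n lam} (h : ∀ k : ℕ, constTerm hn hΘ hlam
      (s * (↑(unitX (Θ := Θ) hn hlam)⁻¹ : SkewQuot Θ n lam) ^ k) = 0) : s = 0 := by
  obtain ⟨c, rfl⟩ := exists_wordPoly hn s
  suffices hc : c = 0 by
    rw [hc]
    exact map_zero (wordEquiv hn hΘ hlam)
  ext j
  have hj := h j
  rw [mk_wordPoly hn hlam, Finset.sum_mul, map_sum, Finset.sum_eq_single j] at hj
  · rw [mul_assoc, ← Units.val_pow_eq_pow_val, ← Units.val_mul, inv_pow, zpow_natCast,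
      mul_inv_cancel] at hj
    have := constTerm_mk_C_mul_zpow (Θ := Θ) hn hΘ hlam (c j) (k := 0) (by omega) (by omega)
    rw [zpow_zero, if_pos rfl] at this
    rw [Pi.zero_apply, ← this, hj]
  · intro i _ hi
    have hij : (i : ℤ) - (j : ℤ) ≠ 0 := fun h => hi (Fin.ext (by omega))
    have hi := i.2
    have hj := j.2
    rw [mul_assoc, ← Units.val_pow_eq_pow_val, ← Units.val_mul, inv_pow, ← zpow_natCast _ (j : ℕ),
      ← zpow_sub, constTerm_mk_C_mul_zpow hn hΘ hlam _ (by omega) (by omega), if_neg hij]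
  · simp

theorem mem_euclideanDual_code (hn : 0 < n) (hΘ : orderOf Θ ∣ n) (hlam : lam = 1 ∨ lam = -1)
    (I : Ideal (SkewQuot Θ n lam)) (v : Fin n → R) :
    v ∈ euclideanDual (code I) ↔
      ∀ t ∈ I, mk Θ n lam (wordPoly Θ v) * anti hn hlam t = 0 := by
  constructor
  · intro hv t ht
    refine eq_zero_of_constTerm hn hΘ hlam fun k => ?_
    -- Orthogonality to xᵏt, which is again in I, controls the constant term of v · anti(t) · x⁻ᵏ.
    obtain ⟨c, hc⟩ := exists_wordPoly hn
      ((unitX (Θ := Θ) hn hlam : SkewQuot Θ n lam) ^ k * t)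
    rw [mul_assoc, ← anti_unitX_pow, ← anti_mul, ← hc, constTerm_mul_anti]
    exact hv c (show _ ∈ I by rw [hc]; exact I.mul_mem_left _ ht)
  · intro h c hc
    rw [← constTerm_mul_anti hn hΘ hlam, h _ hc, map_zero]

/-- The left ideal whose code is the Euclidean dual of the code of `I`. -/
def dualIdeal (hn : 0 < n) (hlam : lam = 1 ∨ lam = -1) (I : Ideal (SkewQuot Θ n lam)) :
    Ideal (SkewQuot Θ n lam) where
  carrier := {s | ∀ t ∈ I, s * anti hn hlam t = 0}
  zero_mem' t _ := zero_mul _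
  add_mem' {a b} ha hb t ht := by rw [add_mul, ha t ht, hb t ht, add_zero]
  smul_mem' a b hb t ht := by rw [smul_eq_mul, mul_assoc, hb t ht, mul_zero]

theorem euclideanDual_code (hn : 0 < n) (hΘ : orderOf Θ ∣ n) (hlam : lam = 1 ∨ lam = -1)
    (I : Ideal (SkewQuot Θ n lam)) :
    euclideanDual (code I) = code (dualIdeal hn hlam I) :=
  Set.ext fun v => mem_euclideanDual_code hn hΘ hlam I v

theorem mem_dualIdeal_iff (hn : 0 < n) (hlam : lam = 1 ∨ lam = -1)
    {I : Ideal (SkewQuot Θ n lam)} {s : SkewQuot Θ n lam} :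
    s ∈ dualIdeal hn hlam I ↔ ∀ t ∈ I, t * anti hn hlam s = 0 := by
  refine forall₂_congr fun t _ => ⟨fun h => ?_, fun h => ?_⟩
  · rw [← anti_anti hn hlam t, ← anti_mul, h, anti_zero]
  · rw [← anti_anti hn hlam s, ← anti_mul, h, anti_zero]

/-- If the right annihilator of the left ideal generated by `s₁, s₂` is the right ideal
generated by `a, b`, then its Euclidean dual is generated by the images of `a` and `b`
under the anti-automorphism. -/
theorem euclideanDual_code_span_pair (hn : 0 < n) (hΘ : orderOf Θ ∣ n)
    (hlam : lam = 1 ∨ lam = -1) {s₁ s₂ a b P Q : SkewPoly Θ} {k l : ℤ}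
    (hP : toLaurent P = xPow Θ k * antiMap a) (hQ : toLaurent Q = xPow Θ l * antiMap b)
    (h1a : mk Θ n lam (s₁ * a) = 0) (h1b : mk Θ n lam (s₁ * b) = 0)
    (h2a : mk Θ n lam (s₂ * a) = 0) (h2b : mk Θ n lam (s₂ * b) = 0)
    (H : ∀ w, mk Θ n lam (s₁ * w) = 0 → mk Θ n lam (s₂ * w) = 0 →
      ∃ p q, mk Θ n lam w = mk Θ n lam (a * p + b * q)) :
    euclideanDual (code (Ideal.span {mk Θ n lam s₁, mk Θ n lam s₂})) =
      code (Ideal.span {mk Θ n lam P, mk Θ n lam Q}) := by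
  rw [euclideanDual_code hn hΘ hlam]
  congr 1
  have hP' := mk_eq_of_toLaurent_eq hn hlam hP
  have hQ' := mk_eq_of_toLaurent_eq hn hlam hQ
  apply le_antisymm
  · intro s hs
    rw [mem_dualIdeal_iff] at hs
    obtain ⟨w, hw⟩ := mk_surjective (anti hn hlam s)
    obtain ⟨p, q, hpq⟩ := H w
      (by rw [map_mul, hw]; exact hs _ (Ideal.subset_span (by simp)))
      (by rw [map_mul, hw]; exact hs _ (Ideal.subset_span (by simp)))
    rw [← anti_anti hn hlam s, ← hw, hpq, map_add, anti_add, map_mul, map_mul, anti_mul, anti_mul]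
    refine Ideal.add_mem _ (Ideal.mul_mem_left _ _ ?_) (Ideal.mul_mem_left _ _ ?_)
    · rw [← (Units.inv_mul_eq_iff_eq_mul _).2 hP']
      exact Ideal.mul_mem_left _ _ (Ideal.subset_span (by simp))
    · rw [← (Units.inv_mul_eq_iff_eq_mul _).2 hQ']
      exact Ideal.mul_mem_left _ _ (Ideal.subset_span (by simp))
  · have key : ∀ c : SkewPoly Θ, mk Θ n lam (s₁ * c) = 0 → mk Θ n lam (s₂ * c) = 0 →
        anti hn hlam (mk Θ n lam c) ∈
          dualIdeal hn hlam (Ideal.span {mk Θ n lam s₁, mk Θ n lam s₂}) := by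
      intro c h1 h2
      rw [mem_dualIdeal_iff]
      intro t ht
      rw [anti_anti]
      induction ht using Submodule.span_induction with
      | mem x hx =>
        rcases hx with rfl | rfl
        · rw [← map_mul, h1]
        · rw [← map_mul, h2]
      | zero => rw [zero_mul]
      | add x y _ _ hx hy => rw [add_mul, hx, hy, add_zero]
      | smul r x _ hx => rw [smul_eq_mul, mul_assoc, hx, mul_zero]
    rw [Ideal.span_le]
    rintro x (rfl | rfl)
    · rw [hP']
      exact Ideal.mul_mem_left _ _ (key a h1a h2a)
    · rw [hQ']
      exact Ideal.mul_mem_left _ _ (key b h1b h2b)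

end General

/-! ### Coefficients in F + uF: the subring F[x; θ] and moving u across a skew polynomial -/

section DualNumbers

variable {F : Type*} [Field F] {Θ : RingAut (DualNumber F)}

/-- With q = |F|, an element a of F satisfies a^q = a, so Ψ(a) is a q-th power. The u-part of a q-th
power carries a factor q, which is 0 in F. -/
theorem DualNumber.snd_ringAut_apply [Finite F] (Ψ : RingAut (DualNumber F)) {a : DualNumber F}
    (ha : TrivSqZeroExt.snd a = 0) : TrivSqZeroExt.snd (Ψ a) = 0 := by
  have : Fintype F := Fintype.ofFinite F
  have h : a ^ Fintype.card F = a := by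
    ext
    · rw [TrivSqZeroExt.fst_pow, FiniteField.pow_card]
    · rw [TrivSqZeroExt.snd_pow, ha, smul_zero, smul_zero]
  rw [← h, map_pow, TrivSqZeroExt.snd_pow, ← Nat.cast_smul_eq_nsmul F,
    FiniteField.cast_card_eq_zero, zero_smul]

/-- The ideal uF consists of the elements of square zero. -/
theorem DualNumber.fst_ringAut_apply (Ψ : RingAut (DualNumber F)) {a : DualNumber F}
    (ha : TrivSqZeroExt.fst a = 0) : TrivSqZeroExt.fst (Ψ a) = 0 := by
  have h : a * a = 0 := by ext <;> simp [ha]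
  have h' : TrivSqZeroExt.fst (Ψ a * Ψ a) = 0 := by rw [← map_mul, h, map_zero]; rfl
  simpa using h'

theorem overField_mul [Finite F] {f g : SkewPoly Θ} (hf : OverField f) (hg : OverField g) :
    OverField (f * g) := by
  intro i
  rw [coeff_mul, map_sum, TrivSqZeroExt.snd_sum]
  refine Finset.sum_eq_zero fun p _ => ?_
  rw [map_mul, toCoeff_symm_twist, TrivSqZeroExt.snd_mul, hf,
    DualNumber.snd_ringAut_apply _ (hg p.2)]
  simp

theorem overField_monomial (i : ℕ) (a : F) :
    OverField (monomial i (toCoeff Θ (TrivSqZeroExt.inl a)) : SkewPoly Θ) := by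
  intro j
  rw [coeff_monomial]
  split_ifs <;> simp

theorem overField_zero : OverField (0 : SkewPoly Θ) := fun i => by simp

variable (Θ) in
/-- The subring `F[x; θ]` of `R[x; Θ]`. -/
def overField [Finite F] : Subring (SkewPoly Θ) where
  carrier := {f | OverField f}
  zero_mem' := overField_zero
  one_mem' := overField_monomial 0 1
  add_mem' ha hb i := by simp [ha i, hb i]
  neg_mem' ha i := by simp [ha i]
  mul_mem' := overField_mul

theorem mem_overField [Finite F] {f : SkewPoly Θ} : f ∈ overField Θ ↔ OverField f := Iff.rfl

theorem overField_modulus [Finite F] {n : ℕ} {lam : DualNumber F} (hlam : lam = 1 ∨ lam = -1) :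
    OverField (modulus Θ n lam) := by
  have hX : (X : SkewPoly Θ) ∈ overField Θ := overField_monomial 1 1
  refine (overField Θ).sub_mem (pow_mem hX n) ?_
  rcases hlam with rfl | rfl
  · rw [map_one, C_1]
    exact one_mem _
  · rw [map_neg, map_one, C_neg, C_1]
    exact neg_mem (one_mem _)

/-- The skew polynomial `f₀` in the decomposition `f = f₀ + u f₁`. -/
def fstPart (f : SkewPoly Θ) : SkewPoly Θ :=
  f.sum fun i a => monomial i (toCoeff Θ (TrivSqZeroExt.inl ((toCoeff Θ).symm a).fst))

/-- The skew polynomial `f₁` in the decomposition `f = f₀ + u f₁`. -/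
def sndPart (f : SkewPoly Θ) : SkewPoly Θ :=
  f.sum fun i a => monomial i (toCoeff Θ (TrivSqZeroExt.inl ((toCoeff Θ).symm a).snd))

theorem coeff_sum_monomial (g : Coeff Θ → Coeff Θ) (hg : g 0 = 0) (f : SkewPoly Θ) (i : ℕ) :
    coeff (f.sum fun j a => monomial j (g a)) i = g (coeff f i) := by
  let e : SkewPoly Θ →+ Coeff Θ := ⟨⟨fun f => coeff f i, rfl⟩, fun f g => coeff_add f g i⟩
  rw [sum_def]
  refine (map_sum e _ _).trans ?_
  change ∑ j ∈ f.support, coeff (monomial j (g (coeff f j))) i = _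
  simp only [coeff_monomial]
  rw [Finset.sum_ite_eq']
  split_ifs with h
  · rfl
  · rw [notMem_support_iff.1 h, hg]

theorem coeff_fstPart (f : SkewPoly Θ) (i : ℕ) :
    coeff (fstPart f) i = toCoeff Θ (TrivSqZeroExt.inl ((toCoeff Θ).symm (coeff f i)).fst) :=
  coeff_sum_monomial _ (by simp) f i

theorem coeff_sndPart (f : SkewPoly Θ) (i : ℕ) :
    coeff (sndPart f) i = toCoeff Θ (TrivSqZeroExt.inl ((toCoeff Θ).symm (coeff f i)).snd) :=
  coeff_sum_monomial _ (by simp) f i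

theorem overField_fstPart (f : SkewPoly Θ) : OverField (fstPart f) := fun i => by
  rw [coeff_fstPart]
  simp

theorem overField_sndPart (f : SkewPoly Θ) : OverField (sndPart f) := fun i => by
  rw [coeff_sndPart]
  simp

theorem coeff_uPoly_mul (f : SkewPoly Θ) (i : ℕ) :
    coeff (uPoly Θ * f) i = toCoeff Θ (DualNumber.eps * (toCoeff Θ).symm (coeff f i)) := by
  rw [uPoly, coeff_C_mul, map_mul, RingEquiv.apply_symm_apply]

theorem fstPart_add_sndPart (f : SkewPoly Θ) : fstPart f + uPoly Θ * sndPart f = f := by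
  ext i
  rw [coeff_add, coeff_uPoly_mul, coeff_fstPart, coeff_sndPart, ← map_add,
    ← (toCoeff Θ).apply_symm_apply (coeff f i)]
  congr 1
  ext <;> simp

theorem symm_coeff_add {a b : SkewPoly Θ} (i : ℕ) :
    (toCoeff Θ).symm (coeff (a + uPoly Θ * b) i) =
      (toCoeff Θ).symm (coeff a i) + DualNumber.eps * (toCoeff Θ).symm (coeff b i) := by
  rw [coeff_add, coeff_uPoly_mul, map_add, RingEquiv.symm_apply_apply]

theorem inl_fst_symm_coeff {a : SkewPoly Θ} (ha : OverField a) (i : ℕ) :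
    toCoeff Θ (TrivSqZeroExt.inl ((toCoeff Θ).symm (coeff a i)).fst) = coeff a i := by
  rw [← RingEquiv.eq_symm_apply]
  ext
  · simp
  · simpa using (ha i).symm

theorem fstPart_add {a b : SkewPoly Θ} (ha : OverField a) :
    fstPart (a + uPoly Θ * b) = a := by
  ext i
  rw [coeff_fstPart, symm_coeff_add, ← inl_fst_symm_coeff ha i]
  simp

theorem sndPart_add {a b : SkewPoly Θ} (ha : OverField a) (hb : OverField b) :
    sndPart (a + uPoly Θ * b) = b := by
  ext i
  have h : ((toCoeff Θ).symm (coeff a i)).snd = 0 := ha i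
  rw [coeff_sndPart, symm_coeff_add, ← inl_fst_symm_coeff hb i]
  simp [h]

theorem fstPart_zero : fstPart (0 : SkewPoly Θ) = 0 := sum_zero_index _

theorem sndPart_zero : sndPart (0 : SkewPoly Θ) = 0 := sum_zero_index _

theorem eq_zero_of_uPoly_mul_eq_zero {b : SkewPoly Θ} (hb : OverField b) (h : uPoly Θ * b = 0) :
    b = 0 := by
  rw [← sndPart_add overField_zero hb, h, add_zero, sndPart_zero]

theorem uPoly_mul_uPoly : uPoly Θ * uPoly Θ = 0 := by
  rw [uPoly, ← C_mul, ← map_mul, DualNumber.eps_mul_eps, map_zero, C_0]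

theorem fst_coeff_mul_uPoly (f : SkewPoly Θ) (i : ℕ) :
    ((toCoeff Θ).symm (coeff (f * uPoly Θ) i)).fst = 0 := by
  rw [uPoly, coeff_mul_C, map_mul, toCoeff_symm_twist, RingEquiv.symm_apply_apply,
    TrivSqZeroExt.fst_mul, DualNumber.fst_ringAut_apply _ DualNumber.fst_eps, mul_zero]

theorem overField_leftShift (f : SkewPoly Θ) : OverField (leftShift f) :=
  overField_sndPart (f * uPoly Θ)

theorem mul_uPoly (f : SkewPoly Θ) : f * uPoly Θ = uPoly Θ * leftShift f := by
  conv_lhs => rw [← fstPart_add_sndPart (f * uPoly Θ)]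
  have h : fstPart (f * uPoly Θ) = 0 := by
    ext i
    rw [coeff_fstPart, fst_coeff_mul_uPoly]
    simp
  rw [h, zero_add]
  rfl

theorem uPoly_mul_mul_uPoly (f : SkewPoly Θ) : uPoly Θ * f * uPoly Θ = 0 := by
  rw [mul_assoc, mul_uPoly, ← mul_assoc, uPoly_mul_uPoly, zero_mul]

theorem uPoly_mul_mul_uPoly_mul (f g : SkewPoly Θ) : uPoly Θ * f * (uPoly Θ * g) = 0 := by
  rw [← mul_assoc, uPoly_mul_mul_uPoly, zero_mul]

/-- Each Θⁱ(u) equals cu with c nonzero in F, by injectivity of Θⁱ, so u · a xⁱ = (c⁻¹a xⁱ) · u. It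
follows that the f with u f in a given left ideal are closed under left multiplication. -/
theorem exists_mul_uPoly_eq (f : SkewPoly Θ) : ∃ g, uPoly Θ * f = g * uPoly Θ := by
  induction f using SkewPolynomial.induction with
  | h0 => exact ⟨0, by simp⟩
  | ha i a f _ _ ih =>
    obtain ⟨g, hg⟩ := ih
    set e : DualNumber F := (Θ ^ i) DualNumber.eps with he
    have he0 : e.fst = 0 := DualNumber.fst_ringAut_apply _ DualNumber.fst_eps
    have he1 : e.snd ≠ 0 := by
      intro h
      have h0 : e = 0 := TrivSqZeroExt.ext he0 h
      rw [he, map_eq_zero_iff _ (Θ ^ i).injective] at h0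
      simpa using congrArg TrivSqZeroExt.snd h0
    refine ⟨monomial i (toCoeff Θ (TrivSqZeroExt.inl e.snd⁻¹) * a) + g, ?_⟩
    have hu : toCoeff Θ DualNumber.eps =
        toCoeff Θ (TrivSqZeroExt.inl e.snd⁻¹) * toCoeff Θ e := by
      rw [← map_mul]
      congr 1
      ext
      · simp [he0]
      · simp [he1]
    rw [mul_add, add_mul, hg, uPoly, C_mul_monomial, monomial_mul_C, twist_apply,
      RingEquiv.symm_apply_apply, ← he, hu, mul_right_comm]

theorem vanishFrom_add_iff {a b : SkewPoly Θ} (ha : OverField a) (hb : OverField b) {k : ℕ} :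
    VanishFrom (a + uPoly Θ * b) k ↔ VanishFrom a k ∧ VanishFrom b k := by
  refine ⟨fun h => ⟨fun i hi => ?_, fun i hi => ?_⟩, fun h => h.1.add (h.2.C_mul _)⟩
  · rw [← fstPart_add (b := b) ha, coeff_fstPart, h i hi]
    simp
  · rw [← sndPart_add ha hb, coeff_sndPart, h i hi]
    simp

theorem MonicAt.left_of_add {a b : SkewPoly Θ} {d : ℕ} (ha : OverField a) (hb : OverField b)
    (h : MonicAt (a + uPoly Θ * b) d) : MonicAt a d := by
  refine ⟨?_, ((vanishFrom_add_iff ha hb).1 h.2).1⟩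
  rw [← fstPart_add (b := b) ha, coeff_fstPart, h.1]
  simp

theorem monicAt_C_inv_mul {f : SkewPoly Θ} {d : ℕ} {c : F} (hc : c ≠ 0)
    (h : coeff f d = toCoeff Θ (TrivSqZeroExt.inl c)) (h' : VanishFrom f (d + 1)) :
    MonicAt (C (toCoeff Θ (TrivSqZeroExt.inl c⁻¹)) * f) d := by
  refine ⟨?_, h'.C_mul _⟩
  rw [coeff_C_mul, h, ← map_mul, ← TrivSqZeroExt.inl_mul, inv_mul_cancel₀ hc,
    TrivSqZeroExt.inl_one, map_one]

theorem MonicAt.exists_div_mod_overField [Finite F] {f g : SkewPoly Θ} {d : ℕ} (hg : MonicAt g d)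
    (hgo : OverField g) (hf : OverField f) :
    ∃ q, OverField q ∧ ∃ r, OverField r ∧ f = q * g + r ∧ VanishFrom r d :=
  hg.exists_div_mod (overField Θ)
    (fun f hf i j => by
      rw [← inl_fst_symm_coeff hf i]
      exact overField_monomial j _) hgo hf

end DualNumbers

/-! ### Elements of minimal degree, and ideals with one monic generator -/

section General

variable {R : Type*} [CommRing R] {Θ : RingAut R} {n : ℕ} {lam : R}
  {I : Ideal (SkewQuot Θ n lam)}

theorem mem_polys_iff {f : SkewPoly Θ} :
    f ∈ polys I ↔ VanishFrom f n ∧ mk Θ n lam f ∈ I :=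
  and_congr degree_lt_iff Iff.rfl

theorem mk_mul_mem (q : SkewPoly Θ) {f : SkewPoly Θ} (hf : mk Θ n lam f ∈ I) :
    mk Θ n lam (q * f) ∈ I := by
  rw [map_mul]
  exact I.mul_mem_left _ hf

theorem mk_add_mem {f g : SkewPoly Θ} (hf : mk Θ n lam f ∈ I) (hg : mk Θ n lam g ∈ I) :
    mk Θ n lam (f + g) ∈ I := by
  rw [map_add]
  exact I.add_mem hf hg

theorem mk_sub_mem {f g : SkewPoly Θ} (hf : mk Θ n lam f ∈ I) (hg : mk Θ n lam g ∈ I) :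
    mk Θ n lam (f - g) ∈ I := by
  rw [map_sub]
  exact I.sub_mem hf hg

theorem mk_mul_modulus (q : SkewPoly Θ) : mk Θ n lam (q * modulus Θ n lam) = 0 := by
  rw [map_mul, mk_modulus, mul_zero]

theorem mk_modulus_mul (q : SkewPoly Θ) : mk Θ n lam (modulus Θ n lam * q) = 0 := by
  rw [map_mul, mk_modulus, zero_mul]

theorem mk_modulus_mem : mk Θ n lam (modulus Θ n lam) ∈ I := by
  rw [mk_modulus]
  exact I.zero_mem

/-- Used to kill remainders of divisions. No bound k ≤ n is needed: f has degree less than n and at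
least k. -/
theorem eq_zero_of_mem_minPolys {f : SkewPoly Θ} (hf : f ∈ minPolys I) {k : ℕ}
    (hk : ¬ VanishFrom f k) {h : SkewPoly Θ} (hI : mk Θ n lam h ∈ I) (hh : VanishFrom h k) :
    h = 0 := by
  by_contra hne
  rcases le_total n k with hnk | hnk
  · exact hk ((mem_polys_iff.1 hf.1).1.mono hnk)
  · exact hk (degree_le_iff.1 (hf.2.2 h (mem_polys_iff.2 ⟨hh.mono hnk, hI⟩) hne) k hh)

theorem C_mul_mem_minPolys {f : SkewPoly Θ} (hf : f ∈ minPolys I) {a : Coeff Θ}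
    (ha : C a * f ≠ 0) : C a * f ∈ minPolys I := by
  have hf' := mem_polys_iff.1 hf.1
  refine ⟨mem_polys_iff.2 ⟨hf'.1.C_mul a, mk_mul_mem _ hf'.2⟩, ha, fun h hh hne => ?_⟩
  exact degree_le_iff.2 fun k hk => (degree_le_iff.1 (hf.2.2 h hh hne) k hk).C_mul a

theorem minPolys_nonempty (hn : 0 < n) (hI : I ≠ ⊥) : (minPolys I).Nonempty := by
  obtain ⟨s, hs, hs0⟩ := Submodule.exists_mem_ne_zero_of_ne_bot hI
  obtain ⟨c, rfl⟩ := exists_wordPoly hn s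
  have hS : {f | f ∈ polys I ∧ f ≠ 0}.Nonempty :=
    ⟨_, mem_polys_iff.2 ⟨vanishFrom_wordPoly c, hs⟩, fun h => hs0 (by rw [h, map_zero])⟩
  obtain ⟨f, hf, hmin⟩ := (InvImage.wf degree wellFounded_lt).has_min _ hS
  exact ⟨f, hf.1, hf.2, fun h hh hne => not_lt.1 (hmin h ⟨hh, hne⟩)⟩

theorem rightQuot_eq {f g q : SkewPoly Θ} {d : ℕ} (hg : MonicAt g d) (h : f = q * g) :
    rightQuot f g = q :=
  hg.mul_right_cancel ((rightQuot_mul ⟨q, h⟩).symm.trans h)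

/-- With M the modulus, ghg = gM = Mg, and the monic g cancels on the right. -/
theorem mul_comm_of_mul_eq_modulus (hΘ : orderOf Θ ∣ n) (hlam : lam = 1 ∨ lam = -1)
    {g h : SkewPoly Θ} {d : ℕ} (hg : MonicAt g d) (e : modulus Θ n lam = h * g) :
    modulus Θ n lam = g * h := by
  refine hg.mul_right_cancel ?_
  rw [mul_assoc, ← e, modulus_mul_comm hΘ hlam]

theorem vanishFrom_of_mul_eq_modulus (hn : 0 < n) {g h : SkewPoly Θ} {d : ℕ} (hg : MonicAt g d)
    (hd : d ≤ n) (e : modulus Θ n lam = h * g) : VanishFrom h (n - d + 1) := by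
  refine hg.vanishFrom_left ?_
  rw [← e, show n - d + 1 + d = n + 1 by omega]
  exact (monicAt_modulus hn).2

theorem toLaurent_C (a : Coeff Θ) : toLaurent (C a) = xPow Θ 0 * antiMap (C a) := by
  have h : antiMap (C a) = xPow Θ 0 * constL a := sum_C_index (by simp [constL])
  rw [h, ← mul_assoc, xPow_mul_xPow, add_zero]
  exact (congrArg toLaurent (by rw [pow_zero, one_mul])).trans (toLaurent_X_pow_mul_C 0 a)

/-- With M = qg = gq, the right annihilator of g is generated by q: gw = Mb = gqb gives w = qb. -/
theorem euclideanDual_of_generator [Nontrivial R] (hn : 0 < n) (hΘ : orderOf Θ ∣ n)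
    (hlam : lam = 1 ∨ lam = -1) {g : SkewPoly Θ} {d : ℕ} (hg : MonicAt g d) (hd : d ≤ n)
    (hgI : mk Θ n lam g ∈ I) (hgen : ∀ f, mk Θ n lam f ∈ I → ∃ q, f = q * g) :
    I = Ideal.span {mk Θ n lam g} ∧ IsRightDivisor g (modulus Θ n lam) ∧
      ∃ P : SkewPoly Θ,
        toLaurent P = xPow Θ ((n : ℤ) - d) * antiMap (rightQuot (modulus Θ n lam) g) ∧
        euclideanDual (code I) = code (Ideal.span {mk Θ n lam P}) := by
  have hspan : I = Ideal.span {mk Θ n lam g} := by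
    apply le_antisymm
    · intro s hs
      obtain ⟨f, rfl⟩ := mk_surjective s
      obtain ⟨q, rfl⟩ := hgen f hs
      rw [map_mul]
      exact Ideal.mul_mem_left _ _ (Ideal.subset_span rfl)
    · rw [Ideal.span_le, Set.singleton_subset_iff]
      exact hgI
  obtain ⟨q, hq⟩ := hgen _ mk_modulus_mem
  have hgq := mul_comm_of_mul_eq_modulus hΘ hlam hg hq
  refine ⟨hspan, ⟨q, hq⟩, ?_⟩
  rw [rightQuot_eq hg hq]
  obtain ⟨P, hP⟩ :=
    exists_toLaurent_eq_of_vanishFrom hd (vanishFrom_of_mul_eq_modulus hn hg hd hq)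
  refine ⟨P, hP, ?_⟩
  have h0 : mk Θ n lam (g * q) = 0 := by rw [← hgq, mk_modulus]
  -- A single generator is treated as a repeated pair.
  rw [hspan, ← Set.pair_eq_singleton (mk Θ n lam g), ← Set.pair_eq_singleton (mk Θ n lam P)]
  refine euclideanDual_code_span_pair hn hΘ hlam hP hP h0 h0 h0 h0 fun w hw _ => ?_
  obtain ⟨b, hb⟩ := (mk_eq_zero_iff hΘ hlam).1 hw
  refine ⟨b, 0, ?_⟩
  rw [← modulus_mul_comm hΘ hlam, hgq, mul_assoc] at hb
  rw [hg.mul_left_cancel hb, mul_zero, add_zero]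

end General

/-! ### Left ideals over F + uF: parts modulo u, and annihilators -/

section DualNumbers

variable {F : Type*} [Field F] {Θ : RingAut (DualNumber F)} {n : ℕ} {lam : DualNumber F}
  {I : Ideal (SkewQuot Θ n lam)}

theorem VanishFrom.uPoly_mul {f : SkewPoly Θ} {k : ℕ} (hf : VanishFrom f k) :
    VanishFrom (uPoly Θ * f) k := hf.C_mul _

theorem mk_uPoly_mul_mul_mem (q : SkewPoly Θ) {g : SkewPoly Θ}
    (hg : mk Θ n lam (uPoly Θ * g) ∈ I) : mk Θ n lam (uPoly Θ * (q * g)) ∈ I := by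
  obtain ⟨q', hq'⟩ := exists_mul_uPoly_eq q
  rw [← mul_assoc, hq', mul_assoc]
  exact mk_mul_mem _ hg

theorem mul_add_eq {q f₀ f₁ : SkewPoly Θ} :
    q * (f₀ + uPoly Θ * f₁) = q * f₀ + uPoly Θ * (leftShift q * f₁) := by
  rw [mul_add, ← mul_assoc, mul_uPoly, mul_assoc]

/-- Divide w by g in F[x; θ] with remainder r: then u r lies in I and has degree below d, so it
vanishes. -/
theorem exists_eq_mul_of_uPoly_mul_mem [Finite F] {g : SkewPoly Θ} {d : ℕ} (hg : MonicAt g d)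
    (hgo : OverField g) (hgI : mk Θ n lam (uPoly Θ * g) ∈ I)
    (hmin : ∀ h, mk Θ n lam h ∈ I → VanishFrom h d → h = 0)
    {w : SkewPoly Θ} (hw : OverField w) (hwI : mk Θ n lam (uPoly Θ * w) ∈ I) :
    ∃ q, OverField q ∧ w = q * g := by
  obtain ⟨q, hq, r, hr, rfl, hv⟩ := hg.exists_div_mod_overField hgo hw
  refine ⟨q, hq, ?_⟩
  have hrI : mk Θ n lam (uPoly Θ * r) ∈ I := by
    have h := mk_sub_mem hwI (mk_uPoly_mul_mul_mem q hgI)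
    rwa [← mul_sub, add_sub_cancel_left] at h
  rw [eq_zero_of_uPoly_mul_eq_zero hr (hmin _ hrI hv.uPoly_mul), add_zero]

/-- Subtracting a multiple of u g brings the u-part below degree d. Minimality of d then forces the
part modulo u to have degree at least d, so the leading coefficient is a nonzero element of F and
can be scaled to 1. -/
theorem exists_monicAt_of_fstPart_ne_zero [Finite F] {g : SkewPoly Θ} {d : ℕ} (hg : MonicAt g d)
    (hgo : OverField g) (hgI : mk Θ n lam (uPoly Θ * g) ∈ I)
    (hmin : ∀ h, mk Θ n lam h ∈ I → VanishFrom h d → h = 0)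
    {f : SkewPoly Θ} (hf : mk Θ n lam f ∈ I) (hf0 : fstPart f ≠ 0) :
    ∃ h, mk Θ n lam h ∈ I ∧ MonicAt h (natDegree (fstPart f)) := by
  obtain ⟨q, hq, r, hr, he, hv⟩ := hg.exists_div_mod_overField hgo (overField_sndPart f)
  have hI : mk Θ n lam (fstPart f + uPoly Θ * r) ∈ I := by
    have h := mk_sub_mem hf (mk_uPoly_mul_mul_mem q hgI)
    rwa [← fstPart_add_sndPart f, he, mul_add, add_sub_assoc, add_sub_cancel_left] at h
  have hfo := overField_fstPart f
  have hd : d ≤ natDegree (fstPart f) := by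
    by_contra hlt
    have h0 := hmin _ hI ((vanishFrom_add_iff hfo hr).2
      ⟨(vanishFrom_natDegree_succ _).mono (by omega), hv⟩)
    rw [← fstPart_add (b := r) hfo, h0, fstPart_zero] at hf0
    exact hf0 rfl
  have hc : coeff (fstPart f + uPoly Θ * r) (natDegree (fstPart f)) =
      coeff (fstPart f) (natDegree (fstPart f)) := by
    rw [coeff_add, hv.uPoly_mul _ hd, add_zero]
  have hc0 := coeff_natDegree_ne_zero hf0
  rw [← inl_fst_symm_coeff hfo] at hc hc0
  refine ⟨_, mk_mul_mem _ hI, monicAt_C_inv_mul ?_ hc ((vanishFrom_add_iff hfo hr).2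
    ⟨vanishFrom_natDegree_succ _, hv.mono (by omega)⟩)⟩
  intro h
  rw [h] at hc0
  simp at hc0

/-- Since the modulus lies in F[x; θ], u-parts can be compared in u f = d(xⁿ - λ). -/
theorem exists_eq_mul_modulus_of_mk_uPoly_mul [Finite F] (hΘ : orderOf Θ ∣ n)
    (hlam : lam = 1 ∨ lam = -1) {f : SkewPoly Θ} (hf : OverField f)
    (h : mk Θ n lam (uPoly Θ * f) = 0) : ∃ b, OverField b ∧ f = b * modulus Θ n lam := by
  obtain ⟨d, hd⟩ := (mk_eq_zero_iff hΘ hlam).1 h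
  have hM : OverField (modulus Θ n lam) := overField_modulus hlam
  refine ⟨sndPart d, overField_sndPart d, ?_⟩
  rw [← sndPart_add overField_zero hf, zero_add, hd, ← fstPart_add_sndPart d, add_mul, mul_assoc,
    sndPart_add (overField_mul (overField_fstPart d) hM)
      (overField_mul (overField_sndPart d) hM),
    sndPart_add (overField_fstPart d) (overField_sndPart d)]

/-- The right annihilator of `u g` modulo `u`, for a monic right divisor `g` of `xⁿ - lam`. -/
theorem exists_fstPart_eq_mul [Finite F] (hΘ : orderOf Θ ∣ n) (hlam : lam = 1 ∨ lam = -1)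
    {g h : SkewPoly Θ} {d : ℕ} (hg : MonicAt g d) (hgo : OverField g)
    (hgh : modulus Θ n lam = g * h) {w : SkewPoly Θ}
    (hw : mk Θ n lam (uPoly Θ * g * w) = 0) : ∃ b, OverField b ∧ fstPart w = h * b := by
  rw [← fstPart_add_sndPart w, mul_add, uPoly_mul_mul_uPoly_mul, add_zero, mul_assoc] at hw
  obtain ⟨b, hb, he⟩ := exists_eq_mul_modulus_of_mk_uPoly_mul hΘ hlam
    (overField_mul hgo (overField_fstPart w)) hw
  rw [← modulus_mul_comm hΘ hlam, hgh, mul_assoc] at he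
  exact ⟨b, hb, hg.mul_left_cancel he⟩

theorem MonicAt.not_vanishFrom_uPoly_mul {g : SkewPoly Θ} {d : ℕ} (hg : MonicAt g d)
    (hgo : OverField g) : ¬ VanishFrom (uPoly Θ * g) d := by
  intro h
  rw [← zero_add (uPoly Θ * g)] at h
  have := ((vanishFrom_add_iff overField_zero hgo).1 h).2 d le_rfl
  rw [hg.1] at this
  have h1 := congrArg (fun a => ((toCoeff Θ).symm a).fst) this
  simp at h1

theorem MonicAt.not_vanishFrom {g : SkewPoly Θ} {d : ℕ} (hg : MonicAt g d) :
    ¬ VanishFrom g d := by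
  intro h
  have := h d le_rfl
  rw [hg.1] at this
  have h1 := congrArg (fun a => ((toCoeff Θ).symm a).fst) this
  simp at h1

/-! ### The three types -/

theorem exists_generator_of_isLI1 (hn : 0 < n) (hΘ : orderOf Θ ∣ n) (hlam : lam = 1 ∨ lam = -1)
    {g₀ g₁ : SkewPoly Θ} (h : IsLI1 I g₀ g₁) :
    MonicAt (g₀ + uPoly Θ * g₁) (natDegree g₀) ∧ natDegree g₀ ≤ n ∧
      mk Θ n lam (g₀ + uPoly Θ * g₁) ∈ I ∧
      ∀ f, mk Θ n lam f ∈ I → ∃ q, f = q * (g₀ + uPoly Θ * g₁) := by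
  have key : ∀ d, MonicAt (g₀ + uPoly Θ * g₁) d → natDegree g₀ = d := fun d hd =>
    (hd.left_of_add h.over₀ h.over₁).natDegree_eq
  rcases h.gen with ⟨rfl, hM⟩ | ⟨hm, hmin⟩
  · have hM' := monicAt_modulus (Θ := Θ) (lam := lam) hn
    rw [← hM] at hM'
    rw [key n hM']
    refine ⟨hM', le_rfl, ?_, fun f hf => ?_⟩
    · rw [hM, mk_modulus]
      exact zero_mem _
    · rw [hM]
      exact (mk_eq_zero_iff hΘ hlam).1 hf
  · rw [key _ hm.monicAt]
    have hp := mem_polys_iff.1 hmin.1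
    refine ⟨hm.monicAt, (natDegree_lt_of_vanishFrom hmin.2.1 hp.1).le, hp.2, fun f hf => ?_⟩
    obtain ⟨q, r, rfl, hr⟩ := hm.monicAt.exists_div_mod' f
    refine ⟨q, ?_⟩
    rw [eq_zero_of_mem_minPolys hmin hm.monicAt.not_vanishFrom ?_ hr, add_zero]
    have := mk_sub_mem hf (mk_mul_mem q hp.2)
    rwa [add_sub_cancel_left] at this

theorem euclideanDual_of_isLI2 [Finite F] (hn : 0 < n) (hΘ : orderOf Θ ∣ n)
    (hlam : lam = 1 ∨ lam = -1) {g₁ : SkewPoly Θ} (h : IsLI2 I g₁) :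
    I = Ideal.span {mk Θ n lam (uPoly Θ * g₁)} ∧
      IsRightDivisor g₁ (modulus Θ n lam) ∧
      ∃ P : SkewPoly Θ,
        toLaurent P = xPow Θ ((n : ℤ) - natDegree g₁) *
          antiMap (rightQuot (modulus Θ n lam) g₁) ∧
        euclideanDual (code I) =
          code (Ideal.span {mk Θ n lam (uPoly Θ), mk Θ n lam P}) := by
  have hg := h.monic₁.monicAt
  set d := natDegree g₁
  have hp := mem_polys_iff.1 h.gen.1
  have hnv := hg.not_vanishFrom_uPoly_mul h.over₁
  have hmin : ∀ f, mk Θ n lam f ∈ I → VanishFrom f d → f = 0 := fun f hf hv =>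
    eq_zero_of_mem_minPolys h.gen hnv hf hv
  have hd : d ≤ n := by
    by_contra hlt
    exact hnv (hp.1.mono (by omega))
  have hspan : I = Ideal.span {mk Θ n lam (uPoly Θ * g₁)} := by
    apply le_antisymm
    · intro s hs
      obtain ⟨c, rfl⟩ := exists_wordPoly hn s
      set f := wordPoly Θ c
      -- A nonzero part modulo u would produce a monic element of the ideal. Taking f of degree less
      -- than n keeps that element among its skew polynomials.
      have hf0 : fstPart f = 0 := by
        by_contra hne
        obtain ⟨m, hmI, hm⟩ := exists_monicAt_of_fstPart_ne_zero hg h.over₁ hp.2 hmin hs hne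
        have hlt : natDegree (fstPart f) < n := by
          refine natDegree_lt_of_vanishFrom hne ?_
          have hv := vanishFrom_wordPoly (Θ := Θ) c
          rw [← fstPart_add_sndPart (wordPoly Θ c),
            vanishFrom_add_iff (overField_fstPart _) (overField_sndPart _)] at hv
          exact hv.1
        exact h.no_monic m (mem_polys_iff.2 ⟨hm.2.mono hlt, hmI⟩) hm.monic
      have hf : f = uPoly Θ * sndPart f := by
        conv_lhs => rw [← fstPart_add_sndPart f, hf0, zero_add]
      rw [hf] at hs ⊢
      obtain ⟨q, -, hq⟩ :=
        exists_eq_mul_of_uPoly_mul_mem hg h.over₁ hp.2 hmin (overField_sndPart f) hs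
      rw [hq]
      exact mk_uPoly_mul_mul_mem q (Ideal.subset_span rfl)
    · rw [Ideal.span_le, Set.singleton_subset_iff]
      exact hp.2
  obtain ⟨q, hqo, hq⟩ := exists_eq_mul_of_uPoly_mul_mem hg h.over₁ hp.2 hmin
    (overField_modulus hlam) (mk_mul_mem _ mk_modulus_mem)
  have hgq := mul_comm_of_mul_eq_modulus hΘ hlam hg hq
  refine ⟨hspan, ⟨q, hq⟩, ?_⟩
  rw [rightQuot_eq hg hq]
  obtain ⟨P, hP⟩ :=
    exists_toLaurent_eq_of_vanishFrom hd (vanishFrom_of_mul_eq_modulus hn hg hd hq)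
  refine ⟨P, hP, ?_⟩
  have h1 : mk Θ n lam (uPoly Θ * g₁ * uPoly Θ) = 0 := by
    rw [uPoly_mul_mul_uPoly, map_zero]
  have h2 : mk Θ n lam (uPoly Θ * g₁ * q) = 0 := by
    rw [mul_assoc, ← hgq, mk_mul_modulus]
  rw [hspan, ← Set.pair_eq_singleton (mk Θ n lam (uPoly Θ * g₁))]
  refine euclideanDual_code_span_pair hn hΘ hlam (toLaurent_C _) hP h1 h2 h1 h2 fun w hw _ => ?_
  obtain ⟨b, -, hb⟩ := exists_fstPart_eq_mul hΘ hlam hg h.over₁ hgq hw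
  exact ⟨sndPart w, b, by rw [← hb, add_comm]; exact congrArg _ (fstPart_add_sndPart w).symm⟩

/-- Division by f₀ modulo u leaves no remainder by the minimality of f₀ + u f₁ among monic elements;
the rest is u times an element of F[x; θ], hence comes from u g₁. -/
theorem exists_eq_mul_add_of_isLI3 [Finite F] {g₁ f₀ f₁ : SkewPoly Θ}
    (h : IsLI3 I g₁ f₀ f₁) (hmin : ∀ f, mk Θ n lam f ∈ I → VanishFrom f (natDegree g₁) → f = 0)
    {f : SkewPoly Θ} (hf : mk Θ n lam f ∈ I) :
    ∃ q q', OverField q ∧ fstPart f = q * f₀ ∧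
      f = q * (f₀ + uPoly Θ * f₁) + uPoly Θ * (q' * g₁) := by
  have hg := h.monic_g₁.monicAt
  have hp := mem_polys_iff.1 h.gen₁.1
  have hF := h.monic_f.monicAt
  have hFp := mem_polys_iff.1 h.gen₂
  set e := natDegree (f₀ + uPoly Θ * f₁)
  have hf₀ : MonicAt f₀ e := hF.left_of_add h.over_f₀ h.over_f₁
  have hen : e < n := natDegree_lt_of_vanishFrom hF.ne_zero hFp.1
  have hzero : ∀ m, mk Θ n lam m ∈ I → VanishFrom (fstPart m) e → fstPart m = 0 := by
    intro m hm hv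
    by_contra hne
    obtain ⟨m', hm'I, hm'⟩ := exists_monicAt_of_fstPart_ne_zero hg h.over_g₁ hp.2 hmin hm hne
    have hlt := natDegree_lt_of_vanishFrom hne hv
    have hle := h.min_f m' (mem_polys_iff.2 ⟨hm'.2.mono (by omega), hm'I⟩) hm'.monic
    exact hF.not_vanishFrom (degree_le_iff.1 hle e (hm'.2.mono hlt))
  obtain ⟨q, hq, r, hr, he, hv⟩ := hf₀.exists_div_mod_overField h.over_f₀ (overField_fstPart f)
  have hsub : f - q * (f₀ + uPoly Θ * f₁) = r + uPoly Θ * (sndPart f - leftShift q * f₁) := by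
    conv_lhs => rw [← fstPart_add_sndPart f, he]
    rw [mul_add_eq, mul_sub]
    abel
  have hI := mk_sub_mem hf (mk_mul_mem q hFp.2)
  have hr0 : r = 0 := by
    have h0 : fstPart (f - q * (f₀ + uPoly Θ * f₁)) = r := by rw [hsub, fstPart_add hr]
    rw [← h0]
    exact hzero _ hI (by rwa [h0])
  rw [hsub, hr0, zero_add] at hI
  obtain ⟨q', -, hq'⟩ := exists_eq_mul_of_uPoly_mul_mem hg h.over_g₁ hp.2 hmin
    (sub_mem (mem_overField.2 (overField_sndPart f))
      (mem_overField.2 (overField_mul (overField_leftShift q) h.over_f₁))) hI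
  refine ⟨q, q', hq, by rw [he, hr0, add_zero], ?_⟩
  rw [← hq', ← sub_eq_iff_eq_add', hsub, hr0, zero_add]

theorem euclideanDual_of_isLI3 [Finite F] (hn : 0 < n) (hΘ : orderOf Θ ∣ n)
    (hlam : lam = 1 ∨ lam = -1) {g₁ f₀ f₁ : SkewPoly Θ} (h : IsLI3 I g₁ f₀ f₁) :
    I = Ideal.span {mk Θ n lam (uPoly Θ * g₁), mk Θ n lam (f₀ + uPoly Θ * f₁)} ∧
      IsRightDivisor g₁ (modulus Θ n lam) ∧ IsRightDivisor f₀ (modulus Θ n lam) ∧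
      ∃ m : SkewPoly Θ, OverField m ∧
        m * g₁ = leftShift (rightQuot (modulus Θ n lam) f₀) * f₁ ∧
        ∃ P₁ P₂ : SkewPoly Θ,
          toLaurent P₁ = xPow Θ ((n : ℤ) - natDegree f₀) *
            antiMap (rightQuot (modulus Θ n lam) f₀ * uPoly Θ) ∧
          toLaurent P₂ = xPow Θ ((n : ℤ) - natDegree g₁) *
            antiMap (rightQuot (modulus Θ n lam) g₁ - uPoly Θ * m) ∧
          euclideanDual (code I) =
            code (Ideal.span {mk Θ n lam P₁, mk Θ n lam P₂}) := by
  have hg := h.monic_g₁.monicAt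
  have hp := mem_polys_iff.1 h.gen₁.1
  have hF := h.monic_f.monicAt
  have hFp := mem_polys_iff.1 h.gen₂
  have hf := hF.left_of_add h.over_f₀ h.over_f₁
  have hen := natDegree_lt_of_vanishFrom hF.ne_zero hFp.1
  rw [← hf.natDegree_eq] at hF hen hf
  set d := natDegree g₁
  set e := natDegree f₀
  have hmin : ∀ f, mk Θ n lam f ∈ I → VanishFrom f d → f = 0 := fun f hf hv =>
    eq_zero_of_mem_minPolys h.gen₁ (hg.not_vanishFrom_uPoly_mul h.over_g₁) hf hv
  have hgen {w : SkewPoly Θ} (hw : OverField w) (hwI : mk Θ n lam (uPoly Θ * w) ∈ I) :=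
    exists_eq_mul_of_uPoly_mul_mem hg h.over_g₁ hp.2 hmin hw hwI
  have hde : d ≤ e := by
    by_contra hlt
    exact hF.ne_zero (hmin _ hFp.2 (hF.2.mono (by omega)))
  have hM := overField_modulus (Θ := Θ) (n := n) hlam
  have hspan : I = Ideal.span {mk Θ n lam (uPoly Θ * g₁), mk Θ n lam (f₀ + uPoly Θ * f₁)} := by
    apply le_antisymm
    · intro s hs
      obtain ⟨f, rfl⟩ := mk_surjective s
      obtain ⟨q, q', -, -, hf⟩ := exists_eq_mul_add_of_isLI3 h hmin hs
      rw [hf]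
      exact mk_add_mem (mk_mul_mem _ (Ideal.subset_span (by simp)))
        (mk_uPoly_mul_mul_mem _ (Ideal.subset_span (by simp)))
    · rw [Ideal.span_le]
      rintro _ (rfl | rfl)
      exacts [hp.2, hFp.2]
  obtain ⟨k, -, hk⟩ := hgen hM (mk_mul_mem _ mk_modulus_mem)
  have hgk := mul_comm_of_mul_eq_modulus hΘ hlam hg hk
  -- The modulus represents 0 in I and is its own part modulo u, so f₀ divides it.
  obtain ⟨l, -, -, hl, -⟩ := exists_eq_mul_add_of_isLI3 h hmin
    (f := modulus Θ n lam) mk_modulus_mem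
  rw [← add_zero (modulus Θ n lam), ← mul_zero (uPoly Θ), fstPart_add hM] at hl
  have hfl := mul_comm_of_mul_eq_modulus hΘ hlam hf hl
  -- Subtracting the modulus l f₀ from l(f₀ + u f₁) leaves l u f₁, a multiple of u in I.
  obtain ⟨m, hmo, hm⟩ := hgen (overField_mul (overField_leftShift l) h.over_f₁) (by
    have hI := mk_sub_mem (mk_mul_mem l hFp.2) mk_modulus_mem
    rwa [mul_add_eq, ← hl, add_sub_cancel_left] at hI)
  -- u(f₀ + u f₁) = u f₀ lies in I, so g₁ divides f₀; this makes f₀ k vanish in the quotient.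
  obtain ⟨a, -, ha⟩ := hgen h.over_f₀ (by
    have hI := mk_mul_mem (uPoly Θ) hFp.2
    rwa [mul_add, ← mul_assoc, uPoly_mul_uPoly, zero_mul, add_zero] at hI)
  have hum : uPoly Θ * m * g₁ = l * uPoly Θ * f₁ := by
    rw [mul_assoc, ← hm, ← mul_assoc, mul_uPoly]
  have hul : VanishFrom (l * uPoly Θ) (n - e + 1) :=
    (vanishFrom_of_mul_eq_modulus hn hf hen.le hl).mul_C (toCoeff Θ DualNumber.eps)
  -- From u m g₁ = l u f₁ and deg f₁ < deg g₁ the degree of u m is less than n - e, hence at most n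
  -- - d, as needed for the second generator to be polynomial.
  have hvm : VanishFrom (uPoly Θ * m) (n - e) := by
    refine hg.vanishFrom_left ?_
    rw [hum]
    exact hul.mul (degree_lt_iff.1 (h.deg_lt.trans_le (degree_le_natDegree g₁)))
  refine ⟨hspan, ⟨k, hk⟩, ⟨l, hl⟩, m, hmo, ?_⟩
  rw [rightQuot_eq hg hk, rightQuot_eq hf hl]
  obtain ⟨P₁, hP₁⟩ := exists_toLaurent_eq_of_vanishFrom hen.le hul
  obtain ⟨P₂, hP₂⟩ := exists_toLaurent_eq_of_vanishFrom (hde.trans hen.le)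
    ((vanishFrom_of_mul_eq_modulus hn hg (hde.trans hen.le) hk).sub (hvm.mono (by omega)))
  refine ⟨hm.symm, P₁, P₂, hP₁, hP₂, ?_⟩
  -- After right multiplication by g₁ both sides equal (xⁿ - λ) u f₁. This is why -u m corrects k to
  -- an annihilator of f₀ + u f₁.
  have hfk : uPoly Θ * f₁ * k = f₀ * (uPoly Θ * m) := by
    refine hg.mul_right_cancel ?_
    rw [mul_assoc, ← hk, mul_assoc f₀, hum, mul_assoc l, ← mul_assoc f₀, ← hfl,
      modulus_mul_comm hΘ hlam]
  have h2 : mk Θ n lam ((f₀ + uPoly Θ * f₁) * (k - uPoly Θ * m)) = 0 := by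
    rw [add_mul, mul_sub, mul_sub, hfk, uPoly_mul_mul_uPoly_mul, sub_zero, sub_add_cancel, ha,
      mul_assoc, ← hgk, mk_mul_modulus]
  rw [hspan]
  refine euclideanDual_code_span_pair hn hΘ hlam hP₁ hP₂ ?_ ?_ ?_ h2 fun w hw hw' => ?_
  · rw [mul_assoc, ← mul_assoc g₁, ← mul_assoc, uPoly_mul_mul_uPoly, map_zero]
  · rw [mul_sub, uPoly_mul_mul_uPoly_mul, sub_zero, mul_assoc, ← hgk, mk_mul_modulus]
  · rw [add_mul, mul_assoc (uPoly Θ), ← mul_assoc f₁, ← mul_assoc (uPoly Θ), uPoly_mul_mul_uPoly,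
      add_zero, ← mul_assoc, ← hfl, mk_modulus_mul]
  · obtain ⟨b, hb, hbw⟩ := exists_fstPart_eq_mul hΘ hlam hg h.over_g₁ hgk hw
    have hdec : w = (k - uPoly Θ * m) * b + uPoly Θ * (m * b + sndPart w) := by
      conv_lhs => rw [← fstPart_add_sndPart w, hbw]
      rw [sub_mul, mul_add, mul_assoc (uPoly Θ) m b]
      abel
    set v := m * b + sndPart w with hv
    have hvo : OverField v :=
      (overField Θ).add_mem (overField_mul hmo hb) (overField_sndPart w)
    rw [hdec, mul_add, ← mul_assoc, map_add, map_mul, h2, zero_mul, zero_add, add_mul,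
      uPoly_mul_mul_uPoly_mul, add_zero, ← mul_assoc, mul_uPoly, mul_assoc] at hw'
    obtain ⟨c, -, hc⟩ := exists_eq_mul_modulus_of_mk_uPoly_mul hΘ hlam
      (overField_mul (overField_leftShift f₀) hvo) hw'
    -- What remains is f₀ u v = u c(xⁿ - λ) = (xⁿ - λ) u c = f₀ l u c, and the monic f₀ cancels.
    have huv : uPoly Θ * v = l * uPoly Θ * c := by
      refine hf.mul_left_cancel ?_
      rw [← mul_assoc, mul_uPoly, mul_assoc, hc, ← mul_assoc, ← modulus_mul_comm hΘ hlam, hfl]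
      simp only [mul_assoc]
    exact ⟨c, b, by rw [← huv, add_comm, ← hdec]⟩

theorem exists_isLI [Finite F] (hn : 0 < n) (hlam : lam = 1 ∨ lam = -1)
    (I : Ideal (SkewQuot Θ n lam)) :
    (∃ g₀ g₁, IsLI1 I g₀ g₁) ∨ (∃ g₁, IsLI2 I g₁) ∨ (∃ g₁ f₀ f₁, IsLI3 I g₁ f₀ f₁) := by
  by_cases hI : I = ⊥
  · exact Or.inl ⟨_, 0, overField_modulus hlam, overField_zero,
      Or.inl ⟨hI, by rw [mul_zero, add_zero]⟩⟩
  by_cases hmon : ∃ h ∈ minPolys I, Monic h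
  · obtain ⟨h, hmin, hm⟩ := hmon
    have hdec := fstPart_add_sndPart h
    exact Or.inl ⟨_, _, overField_fstPart h, overField_sndPart h,
      Or.inr ⟨by rwa [hdec], by rwa [hdec]⟩⟩
  push Not at hmon
  obtain ⟨p, hp⟩ := minPolys_nonempty hn hI
  have hpI := mem_polys_iff.1 hp.1
  have hlead := coeff_natDegree_ne_zero hp.2.1
  have hvan := vanishFrom_natDegree_succ p
  set d := natDegree p
  -- Otherwise the leading coefficient is a unit, and scaling gives a monic element of minimal
  -- degree.
  have hfst : ((toCoeff Θ).symm (coeff p d)).fst = 0 := by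
    by_contra hne
    obtain ⟨a, ha⟩ :=
      (TrivSqZeroExt.isUnit_iff_isUnit_fst.2 (isUnit_iff_ne_zero.2 hne)).exists_left_inv
    have hm : MonicAt (C (toCoeff Θ a) * p) d := by
      refine ⟨?_, hvan.C_mul _⟩
      rw [coeff_C_mul, ← (toCoeff Θ).apply_symm_apply (coeff p d), ← map_mul, ha, map_one]
    exact hmon _ (C_mul_mem_minPolys hp hm.ne_zero) hm.monic
  -- Multiplication by u kills the leading term, so u p falls below the minimal degree; hence p is
  -- itself a multiple of u.
  have hup : uPoly Θ * p = 0 := by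
    refine eq_zero_of_mem_minPolys hp (fun hv => hlead (hv d le_rfl)) (mk_mul_mem _ hpI.2) ?_
    intro i hi
    rcases hi.eq_or_lt with rfl | hi
    · rw [coeff_uPoly_mul, map_eq_zero_iff _ (toCoeff Θ).injective]
      ext <;> simp [hfst]
    · exact hvan.uPoly_mul i hi
  have hp0 : fstPart p = 0 := by
    refine eq_zero_of_uPoly_mul_eq_zero (overField_fstPart p) ?_
    rw [← hup]
    conv_rhs => rw [← fstPart_add_sndPart p]
    rw [mul_add, ← mul_assoc _ (uPoly Θ), uPoly_mul_uPoly, zero_mul, add_zero]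
  have hpu : uPoly Θ * sndPart p = p := by
    conv_rhs => rw [← fstPart_add_sndPart p, hp0, zero_add]
  have hsnd : ((toCoeff Θ).symm (coeff p d)).snd ≠ 0 := by
    intro h0
    refine hlead ?_
    rw [← map_eq_zero_iff _ (toCoeff Θ).symm.injective]
    exact TrivSqZeroExt.ext hfst h0
  set c := ((toCoeff Θ).symm (coeff p d)).snd with hc
  set g := C (toCoeff Θ (TrivSqZeroExt.inl c⁻¹)) * sndPart p with hgdef
  have hg : MonicAt g d := by
    refine monicAt_C_inv_mul hsnd (coeff_sndPart p d) fun i hi => ?_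
    rw [coeff_sndPart, hvan i hi]
    simp
  have hgo : OverField g := overField_mul (overField_monomial 0 c⁻¹) (overField_sndPart p)
  have hug : uPoly Θ * g = C (toCoeff Θ (TrivSqZeroExt.inl c⁻¹)) * p := by
    conv_rhs => rw [← hpu]
    rw [hgdef, uPoly, ← mul_assoc, ← mul_assoc, ← C_mul, ← C_mul, mul_comm]
  have hugm : uPoly Θ * g ∈ minPolys I := by
    rw [hug]
    refine C_mul_mem_minPolys hp ?_
    rw [← hug]
    intro h0
    exact hg.ne_zero (eq_zero_of_uPoly_mul_eq_zero hgo h0)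
  by_cases hno : ∀ h ∈ polys I, ¬ Monic h
  · exact Or.inr (Or.inl ⟨g, hno, hgo, hg.monic, hugm⟩)
  push Not at hno
  refine Or.inr (Or.inr ?_)
  obtain ⟨h, hh, hhmin⟩ := (InvImage.wf (natDegree (Θ := Θ)) wellFounded_lt).has_min
    {h | h ∈ polys I ∧ Monic h} hno
  have hhI := mem_polys_iff.1 hh.1
  have hhm := hh.2.monicAt
  set e := natDegree h
  have hhm' : MonicAt (fstPart h + uPoly Θ * sndPart h) e := by rwa [fstPart_add_sndPart]
  -- Reducing the u-part modulo g secures deg f₁ < deg g₁. As d ≤ e, neither the degree e nor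
  -- monicity is affected.
  obtain ⟨q, -, r, hr, he, hv⟩ := hg.exists_div_mod_overField hgo (overField_sndPart h)
  have hde : d ≤ e := by
    by_contra hlt
    exact hhm.ne_zero (eq_zero_of_mem_minPolys hugm (hg.not_vanishFrom_uPoly_mul hgo) hhI.2
      (hhm.2.mono (by omega)))
  have hen : e < n := natDegree_lt_of_vanishFrom hhm.ne_zero hhI.1
  have hfm := hhm'.left_of_add (overField_fstPart h) (overField_sndPart h)
  have hF : MonicAt (fstPart h + uPoly Θ * r) e :=
    ⟨by rw [coeff_add, hfm.1, hv.uPoly_mul e hde, add_zero],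
      hfm.2.add (hv.mono (by omega)).uPoly_mul⟩
  have hFI : mk Θ n lam (fstPart h + uPoly Θ * r) ∈ I := by
    have hI := mk_sub_mem hhI.2 (mk_uPoly_mul_mul_mem q (mem_polys_iff.1 hugm.1).2)
    rwa [← fstPart_add_sndPart h, he, mul_add, add_sub_assoc, add_sub_cancel_left] at hI
  refine ⟨g, fstPart h, r, hmon, hgo, hg.monic, hugm, overField_fstPart h, hr, hF.monic,
    mem_polys_iff.2 ⟨hF.2.mono hen, hFI⟩, fun h' hh' hm' => ?_, ?_⟩
  · rw [degree_eq_natDegree hF.ne_zero, degree_eq_natDegree hm'.monicAt.ne_zero, hF.natDegree_eq]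
    exact WithBot.coe_le_coe.2 (not_lt.1 (hhmin h' ⟨hh', hm'⟩))
  · rw [degree_eq_natDegree hg.ne_zero, hg.natDegree_eq]
    exact degree_lt_iff.2 hv

end DualNumbers

end SkewCode

end

open SkewCode in
theorem theorem4p6 {F : Type*} [Field F] [Finite F] (Θ : RingAut (DualNumber F))
    (n : ℕ) (hn : 0 < n) (hΘ : orderOf Θ ∣ n)
    (lam : DualNumber F) (hlam : lam = 1 ∨ lam = -1)
    (I : Ideal (SkewQuot Θ n lam)) :
    -- the Euclidean dual is again a left ideal
    (∃ J : Ideal (SkewQuot Θ n lam), euclideanDual (code I) = code J) ∧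
    -- the three cases below cover all left ideals
    ((∃ g₀ g₁, IsLI1 I g₀ g₁) ∨ (∃ g₁, IsLI2 I g₁) ∨ (∃ g₁ f₀ f₁, IsLI3 I g₁ f₀ f₁)) ∧
    -- type LI-1
    (∀ g₀ g₁, IsLI1 I g₀ g₁ →
      I = Ideal.span {mk Θ n lam (g₀ + uPoly Θ * g₁)} ∧
      IsRightDivisor (g₀ + uPoly Θ * g₁) (modulus Θ n lam) ∧
      ∃ P : SkewPoly Θ,
        toLaurent P = xPow Θ ((n : ℤ) - natDegree g₀) *
          antiMap (rightQuot (modulus Θ n lam) (g₀ + uPoly Θ * g₁)) ∧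
        euclideanDual (code I) = code (Ideal.span {mk Θ n lam P})) ∧
    -- type LI-2
    (∀ g₁, IsLI2 I g₁ →
      I = Ideal.span {mk Θ n lam (uPoly Θ * g₁)} ∧
      IsRightDivisor g₁ (modulus Θ n lam) ∧
      ∃ P : SkewPoly Θ,
        toLaurent P = xPow Θ ((n : ℤ) - natDegree g₁) *
          antiMap (rightQuot (modulus Θ n lam) g₁) ∧
        euclideanDual (code I) =
          code (Ideal.span {mk Θ n lam (uPoly Θ), mk Θ n lam P})) ∧
    -- type LI-3
    (∀ g₁ f₀ f₁, IsLI3 I g₁ f₀ f₁ →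
      I = Ideal.span {mk Θ n lam (uPoly Θ * g₁), mk Θ n lam (f₀ + uPoly Θ * f₁)} ∧
      IsRightDivisor g₁ (modulus Θ n lam) ∧ IsRightDivisor f₀ (modulus Θ n lam) ∧
      ∃ m : SkewPoly Θ, OverField m ∧
        m * g₁ = leftShift (rightQuot (modulus Θ n lam) f₀) * f₁ ∧
        ∃ P₁ P₂ : SkewPoly Θ,
          toLaurent P₁ = xPow Θ ((n : ℤ) - natDegree f₀) *
            antiMap (rightQuot (modulus Θ n lam) f₀ * uPoly Θ) ∧
          toLaurent P₂ = xPow Θ ((n : ℤ) - natDegree g₁) *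
            antiMap (rightQuot (modulus Θ n lam) g₁ - uPoly Θ * m) ∧
          euclideanDual (code I) =
            code (Ideal.span {mk Θ n lam P₁, mk Θ n lam P₂})) := by
  have hI {g₀ g₁ : SkewPoly Θ} (h : IsLI1 I g₀ g₁) :=
    exists_generator_of_isLI1 hn hΘ hlam h
  exact ⟨⟨_, euclideanDual_code hn hΘ hlam I⟩, exists_isLI hn hlam I,
    fun _ _ h => euclideanDual_of_generator hn hΘ hlam (hI h).1 (hI h).2.1 (hI h).2.2.1
      (hI h).2.2.2,
    fun _ h => euclideanDual_of_isLI2 hn hΘ hlam h,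
    fun _ _ _ h => euclideanDual_of_isLI3 hn hΘ hlam h⟩
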